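/- **Setting.** Let $\Omega\subset\mathbb R^d$ be a bounded open set (bounded with sufficiently smooth boundary, $d\le 3$, in applications), $T>0$, $\|\cdot\|$ the norm of $L^2(\Omega)$, and let $\mathbb W\subset L^2(\Omega)$ be a function space with its own norm $\|\cdot\|_{\mathbb W}$. Let $\gamma:(0,1)\to[1,\infty)$ satisfy $\gamma(\varepsilon)\to\infty$ as $\varepsilon\to0^+$. For $\varepsilon\in(0,1)$ let $\mathbf Q_\varepsilon$ be a linear (in general unbounded) operator in $L^2(\Omega)$ whose domain contains $\mathbb W$, let $\mathbf P_\varepsilon:L^2(\Omega)\to L^2(\Omega)$ be linear, and suppose that, with constants $C_0,C_1>0$ independent of $\varepsilon$, $$\|\mathbf Q_\varepsilon h\|\le C_0\|h\|_{\mathbb W}/\gamma(\varepsilon)\ \ (h\in\mathbb W),\qquad \|\mathbf P_\varepsilon h\|\le C_1\log(\gamma(\varepsilon))\,\|h\|\ \ (h\in L^2(\Omega)),\qquad \mathbf P_\varepsilon=2\Delta+\mathbf Q_\varepsilon ,$$ the last identity being understood weakly, $\langle\mathbf P_\varepsilon h,\varphi\rangle=-2\langle\nabla h,\nabla\varphi\rangle+\langle\mathbf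 Q_\varepsilon h,\varphi\rangle$ for $\varphi\in H^1_0(\Omega)$ and $h\in H^1_0(\Omega)$ in the domain of $\mathbf Q_\varepsilon$. A *weak solution* of either problem below is a $u\in L^2(0,T;H^1_0(\Omega))$ with $u_t\in L^2(0,T;H^1(\Omega))$ and $u_{tt}\in L^2(0,T;H^{-1}(\Omega))$, identified with its representative with $u\in C([0,T];H^1_0(\Omega))$, $u_t\in C([0,T];L^2(\Omega))$, which satisfies the equation tested with every $\varphi\in H^1_0(\Omega)$ for a.e. $t\in(0,T)$, and the terminal conditions. Let $u$ be a weak solution of the original problem $$u_{tt}+u_t-\Delta u-\Delta u_t=0\ \text{ in }\Omega\times(0,T),\qquad u=0\ \text{ on }\partial\Omega\times(0,T),\qquad u(T)=f_0,\ u_t(T)=f_1,$$ such that $u\in C([0,T];\mathbb W)$, $u_t\in L^2(0,T;\mathbb W)$ and $\|u\|^2_{C([0,T];\mathbb W)}+\|u_t\|^2_{L^2(0,T;\mathbb W)}\le M$. For $\varepsilon\in(0,1)$ let $u^\varepsilon$ be a weak solution of the regularized problem $$u^\varepsilon_{tt}+u^\varepsilon_t+\Delta u^\varepsilon+\Delta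 u^\varepsilon_t=\mathbf P_\varepsilon u^\varepsilon+\mathbf P_\varepsilon u^\varepsilon_t\ \text{ in }\Omega\times(0,T),\qquad u^\varepsilon=0\ \text{ on }\partial\Omega\times(0,T),\qquad u^\varepsilon(T)=f_0^\varepsilon,\ u^\varepsilon_t(T)=f_1^\varepsilon,$$ with data such that $\|f_0^\varepsilon-f_0\|_{H^1(\Omega)}+\|f_1^\varepsilon-f_1\|\le\varepsilon$. **Theorem 2.** Assume $3C_1T<2$, and let $K\in\mathbb R$. There is a constant $C>0$, depending only on $K,M,C_0,C_1$ (in particular not on $\varepsilon$), such that for all $0\le t\le T$, with $\gamma=\gamma(\varepsilon)$, $$\|u^\varepsilon(t)-u(t)\|^2\le C\left(\varepsilon+(\log\gamma)^{-1}\gamma^{3C_1(T-t)-2}\right),$$ $$\|\nabla u^\varepsilon(t)-\nabla u(t)\|^2\le C\left(\varepsilon\log\gamma+\gamma^{3C_1(T-t)-2}\right),$$ $$\|u^\varepsilon_t(t)-u_t(t)\|^2+\int_t^T\|\nabla u^\varepsilon_t(s)-\nabla u_t(s)\|^2\,ds\le C\left((\log\gamma)^2\varepsilon+\log\gamma\;\gamma^{3C_1(T-t)-2}\right)$$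 hold in each of the following cases: (i) for every $\varepsilon\in(0,1)$ with $\gamma(\varepsilon)\ge e^{2/C_1}$ and $\gamma(\varepsilon)^2\varepsilon\le K$; (ii) if $\lim_{\varepsilon\to0^+}\gamma(\varepsilon)^2\varepsilon$ exists and is at most $K$, for every sufficiently small $\varepsilon>0$ (how small depends only on $\gamma$, $K$ and $C_1$). -/

import Mathlib

open MeasureTheory Set Filter Topology
open scoped ContDiff

noncomputable section

namespace QuasiReversibility

/-- Smooth compactly supported real functions on an open set `U`. -/
structure IsTestFunction {E : Type*} [NormedAddCommGroup E] [NormedSpace ℝ E]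
    (U : Set E) (φ : E → ℝ) : Prop where
  smooth : ContDiff ℝ ∞ φ
  compact : HasCompactSupport φ
  support_subset : tsupport φ ⊆ U

/-! ### Sobolev spaces on a subset of Euclidean space -/

/-- The Euclidean space `ℝ^d`. -/
abbrev Eu (d : ℕ) : Type := EuclideanSpace ℝ (Fin d)

variable {d : ℕ}

/-- `L²(Ω)`. -/
abbrev L2 (Ω : Set (Eu d)) : Type := Lp ℝ 2 (volume.restrict Ω)

/-- Square integrable vector fields on `Ω`. -/
abbrev L2Vec (Ω : Set (Eu d)) : Type := Lp (Eu d) 2 (volume.restrict Ω)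

/-- The vector field `g` is the weak gradient of `f` on `Ω`. -/
def IsWeakGradient (Ω : Set (Eu d)) (f : L2 Ω) (g : L2Vec Ω) : Prop :=
  ∀ φ : Eu d → ℝ, IsTestFunction Ω φ → ∀ i : Fin d,
    ∫ x in Ω, f x * fderiv ℝ φ x (EuclideanSpace.single i 1) = - ∫ x in Ω, g x i * φ x

theorem IsTestFunction.memLp {Ω : Set (Eu d)} {φ : Eu d → ℝ} (h : IsTestFunction Ω φ) :
    MemLp φ 2 (volume.restrict Ω) :=
  h.smooth.continuous.memLp_of_hasCompactSupport h.compact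

theorem IsTestFunction.memLp_partial {Ω : Set (Eu d)} {φ : Eu d → ℝ} (h : IsTestFunction Ω φ)
    (v : Eu d) : MemLp (fun x => fderiv ℝ φ x v) 2 (volume.restrict Ω) :=
  ((h.smooth.continuous_fderiv (by simp)).clm_apply continuous_const).memLp_of_hasCompactSupport
    (h.compact.fderiv_apply (𝕜 := ℝ) v)

theorem memLp_coord {Ω : Set (Eu d)} (g : L2Vec Ω) (i : Fin d) :
    MemLp (fun x => g x i) 2 (volume.restrict Ω) :=
  (EuclideanSpace.proj i : Eu d →L[ℝ] ℝ).comp_memLp' (Lp.memLp g)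

/-- The pairs `(f, ∇f)` in `L²(Ω) × L²(Ω; ℝ^d)`, where `∇f` is the weak gradient of `f`. -/
def gradientGraph (Ω : Set (Eu d)) : Submodule ℝ (WithLp 2 (L2 Ω × L2Vec Ω)) where
  carrier := {p | IsWeakGradient Ω p.fst p.snd}
  zero_mem' := by
    intro φ hφ i
    have h1 : ∫ x in Ω, (0 : L2 Ω) x * fderiv ℝ φ x (EuclideanSpace.single i 1) = 0 := by
      apply integral_eq_zero_of_ae
      filter_upwards [Lp.coeFn_zero ℝ 2 (volume.restrict Ω)] with x hx
      rw [hx]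
      simp
    have h2 : ∫ x in Ω, (0 : L2Vec Ω) x i * φ x = 0 := by
      apply integral_eq_zero_of_ae
      filter_upwards [Lp.coeFn_zero (Eu d) 2 (volume.restrict Ω)] with x hx
      rw [hx]
      simp
    simp only [WithLp.zero_fst, WithLp.zero_snd]
    rw [h1, h2, neg_zero]
  add_mem' := by
    intro p q hp hq φ hφ i
    have h1 : ∫ x in Ω, (p.fst + q.fst) x * fderiv ℝ φ x (EuclideanSpace.single i 1)
        = (∫ x in Ω, p.fst x * fderiv ℝ φ x (EuclideanSpace.single i 1))
          + ∫ x in Ω, q.fst x * fderiv ℝ φ x (EuclideanSpace.single i 1) := by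
      refine Eq.trans ?_ (integral_add ((Lp.memLp p.fst).integrable_mul (hφ.memLp_partial _))
        ((Lp.memLp q.fst).integrable_mul (hφ.memLp_partial _)))
      apply integral_congr_ae
      filter_upwards [Lp.coeFn_add p.fst q.fst] with x hx
      rw [hx]
      simp [add_mul]
    have h2 : ∫ x in Ω, (p.snd + q.snd) x i * φ x
        = (∫ x in Ω, p.snd x i * φ x) + ∫ x in Ω, q.snd x i * φ x := by
      refine Eq.trans ?_ (integral_add ((memLp_coord p.snd i).integrable_mul hφ.memLp)
        ((memLp_coord q.snd i).integrable_mul hφ.memLp))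
      apply integral_congr_ae
      filter_upwards [Lp.coeFn_add p.snd q.snd] with x hx
      rw [hx]
      simp [add_mul]
    simp only [WithLp.add_fst, WithLp.add_snd]
    rw [h1, h2, hp φ hφ i, hq φ hφ i]
    ring
  smul_mem' := by
    intro c p hp φ hφ i
    have h1 : ∫ x in Ω, (c • p.fst) x * fderiv ℝ φ x (EuclideanSpace.single i 1)
        = c * ∫ x in Ω, p.fst x * fderiv ℝ φ x (EuclideanSpace.single i 1) := by
      rw [← integral_const_mul]
      apply integral_congr_ae
      filter_upwards [Lp.coeFn_smul c p.fst] with x hx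
      simp [hx, mul_assoc]
    have h2 : ∫ x in Ω, (c • p.snd) x i * φ x = c * ∫ x in Ω, p.snd x i * φ x := by
      rw [← integral_const_mul]
      apply integral_congr_ae
      filter_upwards [Lp.coeFn_smul c p.snd] with x hx
      simp [hx, mul_assoc]
    simp only [WithLp.smul_fst, WithLp.smul_snd]
    rw [h1, h2, hp φ hφ i]
    ring

/-- Integration against an `L²` function is continuous on `L²`. -/
theorem continuous_integral_mul {Ω : Set (Eu d)} {ψ : Eu d → ℝ}
    (hψ : MemLp ψ 2 (volume.restrict Ω)) :
    Continuous fun f : L2 Ω => ∫ x in Ω, f x * ψ x := by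
  have h : (fun f : L2 Ω => ∫ x in Ω, f x * ψ x) = fun f => inner ℝ (hψ.toLp ψ) f := by
    funext f
    rw [L2.inner_def]
    apply integral_congr_ae
    filter_upwards [hψ.coeFn_toLp] with x hx
    simp [hx]
  rw [h]
  fun_prop

theorem isClosed_gradientGraph (Ω : Set (Eu d)) :
    IsClosed (gradientGraph Ω : Set (WithLp 2 (L2 Ω × L2Vec Ω))) := by
  have : (gradientGraph Ω : Set (WithLp 2 (L2 Ω × L2Vec Ω)))
      = ⋂ (φ : Eu d → ℝ) (_ : IsTestFunction Ω φ) (i : Fin d),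
        {p | ∫ x in Ω, p.fst x * fderiv ℝ φ x (EuclideanSpace.single i 1)
          = - ∫ x in Ω, p.snd x i * φ x} := by
    ext p
    simp only [mem_iInter]
    rfl
  rw [this]
  refine isClosed_iInter fun φ => isClosed_iInter fun hφ => isClosed_iInter fun i => ?_
  refine isClosed_eq ?_ ?_
  · exact (continuous_integral_mul (hφ.memLp_partial _)).comp
      (WithLp.fstL 2 ℝ (L2 Ω) (L2Vec Ω)).continuous
  · have h2 : (fun p : WithLp 2 (L2 Ω × L2Vec Ω) => ∫ x in Ω, p.snd x i * φ x) = fun p =>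
        ∫ x in Ω, ((EuclideanSpace.proj i : Eu d →L[ℝ] ℝ).compLpL 2
          (volume.restrict Ω) (WithLp.sndL 2 ℝ (L2 Ω) (L2Vec Ω) p)) x * φ x := by
      funext p
      apply integral_congr_ae
      filter_upwards [(EuclideanSpace.proj i : Eu d →L[ℝ] ℝ).coeFn_compLpL
        (WithLp.sndL 2 ℝ (L2 Ω) (L2Vec Ω) p)] with x hx
      simp only [hx]
      rfl
    refine Continuous.neg ?_
    rw [h2]
    exact (continuous_integral_mul hφ.memLp).comp (ContinuousLinearMap.continuous _ |>.comp
      (WithLp.sndL 2 ℝ (L2 Ω) (L2Vec Ω)).continuous)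

/-- The Sobolev space `H¹(Ω)`, with the Hilbert norm `‖f‖²_{H¹} = ‖f‖² + ‖∇f‖²`; a function is
stored with its weak gradient, which it determines. -/
def H1 (Ω : Set (Eu d)) : Type := gradientGraph Ω

instance (Ω : Set (Eu d)) : NormedAddCommGroup (H1 Ω) :=
  inferInstanceAs (NormedAddCommGroup (gradientGraph Ω))

instance (Ω : Set (Eu d)) : InnerProductSpace ℝ (H1 Ω) :=
  inferInstanceAs (InnerProductSpace ℝ (gradientGraph Ω))

/-- `H¹(Ω)` is complete, so that Bochner integrals of `H¹(Ω)`-valued functions make sense. -/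
instance (Ω : Set (Eu d)) : CompleteSpace (H1 Ω) :=
  (isClosed_gradientGraph Ω).completeSpace_coe

/-- The function underlying an element of `H¹(Ω)`. -/
def H1.val {Ω : Set (Eu d)} : H1 Ω →L[ℝ] L2 Ω :=
  (WithLp.fstL 2 ℝ (L2 Ω) (L2Vec Ω)).comp (gradientGraph Ω).subtypeL

/-- The weak gradient of an element of `H¹(Ω)`. -/
def H1.grad {Ω : Set (Eu d)} : H1 Ω →L[ℝ] L2Vec Ω :=
  (WithLp.sndL 2 ℝ (L2 Ω) (L2Vec Ω)).comp (gradientGraph Ω).subtypeL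

/-- `H¹₀(Ω)`: the closure in `H¹(Ω)` of the test functions on `Ω`. -/
def H10 (Ω : Set (Eu d)) : Submodule ℝ (H1 Ω) :=
  (Submodule.span ℝ {p : H1 Ω | ∃ φ : Eu d → ℝ, IsTestFunction Ω φ ∧
    H1.val p =ᵐ[volume.restrict Ω] φ}).topologicalClosure

/-- `H⁻¹(Ω)`, the dual of `H¹₀(Ω)`. -/
abbrev Hneg1 (Ω : Set (Eu d)) : Type := StrongDual ℝ (H10 Ω)

/-- The embedding `L²(Ω) → H⁻¹(Ω)`, `f ↦ ⟨f, ·⟩`. -/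
def toHneg1 {Ω : Set (Eu d)} (f : L2 Ω) : Hneg1 Ω :=
  (innerSL ℝ f).comp (H1.val.comp (H10 Ω).subtypeL)

/-! ### Evolution in time -/

/-- `g` is the weak derivative of `f` on the time interval `(0, T)`. -/
def HasWeakTimeDeriv {X : Type*} [NormedAddCommGroup X] [NormedSpace ℝ X]
    (T : ℝ) (f g : ℝ → X) : Prop :=
  ∀ ψ : ℝ → ℝ, IsTestFunction (Ioo 0 T) ψ →
    ∫ t in Ioo 0 T, deriv ψ t • f t = - ∫ t in Ioo 0 T, ψ t • g t

/-- The regularity class of weak solutions: `u ∈ L²(0,T; H¹₀(Ω))` with `u_t ∈ L²(0,T; H¹(Ω))`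
and `u_tt ∈ L²(0,T; H⁻¹(Ω))`. As usual, `u` and `u_t` are identified with their representatives
`pos ∈ C([0,T]; H¹₀(Ω))` and `vel ∈ C([0,T]; L²(Ω))`, so that they have values at every time;
`velH1` is `u_t` as an `H¹(Ω)`-valued function defined for almost every time. -/
structure Trajectory (Ω : Set (Eu d)) (T : ℝ) where
  pos : ℝ → H10 Ω
  vel : ℝ → L2 Ω
  velH1 : ℝ → H1 Ω
  acc : ℝ → Hneg1 Ω
  continuousOn_pos : ContinuousOn pos (Icc 0 T)
  continuousOn_vel : ContinuousOn vel (Icc 0 T)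
  memLp_velH1 : MemLp velH1 2 (volume.restrict (Ioo 0 T))
  memLp_acc : MemLp acc 2 (volume.restrict (Ioo 0 T))
  vel_eq : ∀ᵐ t ∂volume.restrict (Ioo 0 T), vel t = H1.val (velH1 t)
  deriv_pos : HasWeakTimeDeriv T (fun t => (pos t : H1 Ω)) velH1
  deriv_vel : HasWeakTimeDeriv T (fun t => toHneg1 (vel t)) acc

/-- The terminal conditions `u(T) = f₀`, `u_t(T) = f₁`. -/
def Trajectory.HasTerminalData {Ω : Set (Eu d)} {T : ℝ} (y : Trajectory Ω T)
    (f₀ : H1 Ω) (f₁ : L2 Ω) : Prop :=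
  (y.pos T : H1 Ω) = f₀ ∧ y.vel T = f₁

/-- `y` is a weak solution of `u_tt + u_t - Δu - Δu_t = 0` in `Ω × (0,T)`, `u = 0` on the
boundary. -/
def IsExactSolution {Ω : Set (Eu d)} {T : ℝ} (y : Trajectory Ω T) : Prop :=
  ∀ φ : H10 Ω, ∀ᵐ t ∂volume.restrict (Ioo 0 T),
    y.acc t φ + inner ℝ (y.vel t) (H1.val (φ : H1 Ω))
      + inner ℝ (H1.grad (y.pos t : H1 Ω)) (H1.grad (φ : H1 Ω))
      + inner ℝ (H1.grad (y.velH1 t)) (H1.grad (φ : H1 Ω)) = 0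

/-- `y` is a weak solution of `u_tt + u_t + Δu + Δu_t = P u + P u_t` in `Ω × (0,T)`, `u = 0` on
the boundary. -/
def IsRegularizedSolution {Ω : Set (Eu d)} {T : ℝ} (P : L2 Ω →ₗ[ℝ] L2 Ω)
    (y : Trajectory Ω T) : Prop :=
  ∀ φ : H10 Ω, ∀ᵐ t ∂volume.restrict (Ioo 0 T),
    y.acc t φ + inner ℝ (y.vel t) (H1.val (φ : H1 Ω))
      - inner ℝ (H1.grad (y.pos t : H1 Ω)) (H1.grad (φ : H1 Ω))
      - inner ℝ (H1.grad (y.velH1 t)) (H1.grad (φ : H1 Ω))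
      = inner ℝ (P (H1.val (y.pos t : H1 Ω))) (H1.val (φ : H1 Ω))
        + inner ℝ (P (y.vel t)) (H1.val (φ : H1 Ω))

/-! ### Perturbing and stabilized operators -/

/-- The auxiliary function: `γ(ε) ≥ 1` on `(0,1)` and `γ(ε) → ∞` as `ε → 0+`. -/
def IsAuxiliary (γ : ℝ → ℝ) : Prop :=
  (∀ ε ∈ Ioo (0 : ℝ) 1, 1 ≤ γ ε) ∧ Tendsto γ (𝓝[>] 0) atTop

/-- Perturbing operators: `‖Q_ε u‖ ≤ C₀ ‖u‖_W / γ(ε)` for `u ∈ W`, where the function space `W`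
is included in `L²(Ω)` through `ι`. The operators `Q_ε` are linear operators in `L²(Ω)`, in general
unbounded, whose domains contain `W`. -/
def IsPerturbing {Ω : Set (Eu d)} {W : Type*} [NormedAddCommGroup W] [NormedSpace ℝ W]
    (ι : W →ₗ[ℝ] L2 Ω) (γ : ℝ → ℝ) (C₀ : ℝ) (Q : ℝ → L2 Ω →ₗ.[ℝ] L2 Ω) : Prop :=
  ∀ ε ∈ Ioo (0 : ℝ) 1, ∀ w : W, ∃ h : ι w ∈ (Q ε).domain,
    ‖Q ε ⟨ι w, h⟩‖ ≤ C₀ * ‖w‖ / γ ε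

/-- Stabilized operators: `‖P_ε u‖ ≤ C₁ log(γ(ε)) ‖u‖` for `u ∈ L²(Ω)`. -/
def IsStabilized {Ω : Set (Eu d)} (γ : ℝ → ℝ) (C₁ : ℝ) (P : ℝ → L2 Ω →ₗ[ℝ] L2 Ω) : Prop :=
  ∀ ε ∈ Ioo (0 : ℝ) 1, ∀ h : L2 Ω, ‖P ε h‖ ≤ C₁ * Real.log (γ ε) * ‖h‖

/-- `P_ε = 2Δ + Q_ε`, where `Δ` is the weak Laplacian with Dirichlet boundary condition. -/
def IsLaplacePerturbation {Ω : Set (Eu d)} (P : ℝ → L2 Ω →ₗ[ℝ] L2 Ω)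
    (Q : ℝ → L2 Ω →ₗ.[ℝ] L2 Ω) : Prop :=
  ∀ ε ∈ Ioo (0 : ℝ) 1, ∀ (h : H10 Ω) (hd : H1.val (h : H1 Ω) ∈ (Q ε).domain) (φ : H10 Ω),
    inner ℝ (P ε (H1.val (h : H1 Ω))) (H1.val (φ : H1 Ω))
      = -2 * inner ℝ (H1.grad (h : H1 Ω)) (H1.grad (φ : H1 Ω))
        + inner ℝ (Q ε ⟨H1.val (h : H1 Ω), hd⟩) (H1.val (φ : H1 Ω))

/-- `u ∈ C([0,T]; W)`, `u_t ∈ L²(0,T; W)` and `‖u‖²_{C([0,T];W)} + ‖u_t‖²_{L²(0,T;W)} ≤ M`. -/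
def Trajectory.HasSourceBound {Ω : Set (Eu d)} {T : ℝ} (y : Trajectory Ω T) {W : Type*}
    [NormedAddCommGroup W] [NormedSpace ℝ W] (ι : W →ₗ[ℝ] L2 Ω) (M : ℝ) : Prop :=
  ∃ U V : ℝ → W,
    ContinuousOn U (Icc 0 T) ∧ (∀ t ∈ Icc 0 T, ι (U t) = H1.val (y.pos t : H1 Ω)) ∧
    MemLp V 2 (volume.restrict (Ioo 0 T)) ∧
    (∀ᵐ t ∂volume.restrict (Ioo 0 T), ι (V t) = y.vel t) ∧
    ∀ t ∈ Icc 0 T, ‖U t‖ ^ 2 + ∫ s in Ioo 0 T, ‖V s‖ ^ 2 ≤ M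

/-- The three error estimates at noise level `ε`, with `g = γ(ε)` and constant `C`. -/
def ErrorEstimates {Ω : Set (Eu d)} {T : ℝ} (C C₁ g ε : ℝ) (y z : Trajectory Ω T) : Prop :=
  ∀ t ∈ Icc 0 T,
    ‖H1.val (y.pos t : H1 Ω) - H1.val (z.pos t : H1 Ω)‖ ^ 2
      ≤ C * (ε + (Real.log g)⁻¹ * g ^ (3 * C₁ * (T - t) - 2)) ∧
    ‖H1.grad (y.pos t : H1 Ω) - H1.grad (z.pos t : H1 Ω)‖ ^ 2
      ≤ C * (Real.log g * ε + g ^ (3 * C₁ * (T - t) - 2)) ∧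
    ‖y.vel t - z.vel t‖ ^ 2
        + ∫ s in Ioo t T, ‖H1.grad (y.velH1 s) - H1.grad (z.velH1 s)‖ ^ 2
      ≤ C * (Real.log g ^ 2 * ε + Real.log g * g ^ (3 * C₁ * (T - t) - 2))

end QuasiReversibility

end

/-! Let `w = u^ε - u` and `a = C₁ log γ`, so that `‖P_ε h‖ ≤ a ‖h‖`. Adding `2Δu + 2Δu_t` to both
sides of the original equation and replacing `2Δ` by `P_ε - Q_ε` shows that `w` solves the
regularized equation up to the residual `Q_ε u + Q_ε u_t`, which is at most `C₀ (‖u‖_W + ‖u_t‖_W) /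
γ`.

Test with `p = w_t + a w`. The cross terms `⟨w, p⟩` and `⟨∇w, ∇p⟩` are absorbed by the weights `a² -
a` and `a - 1` in the energy `E = ‖p‖² + (a² - a)‖w‖² + (a - 1)‖∇w‖²`, and what remains is `E' + 3aE
≥ 2‖∇p‖² - r²` (`energy_derivative_bound`). Integration back from `T` gives `E(t) + 2∫‖∇p‖² ≤
e^{3a(T-t)} (E(T) + ∫r²)`, where `e^{3a(T-t)} = γ^{3C₁(T-t)}`. Since `E(T) ≤ 2a²ε²` and `∫r² =
O(γ^{-2})`, the assumptions `γ²ε ≤ k` and `3C₁T < 2` bound the right side by a multiple of `a²ε +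
γ^{3C₁(T-t)-2}`. The energy controls `a²‖w‖²`, `a‖∇w‖²` and `‖w_t‖²`, whence the three different
powers of `log γ`.

Weak solutions are too rough to be differentiated in this way. The equation is linear with
coefficients independent of time, so mollification in time preserves it away from `0` and `T`. The
inequality is proved for the mollified functions, passed to the limit by continuity and Fatou's
lemma, and extended to the endpoints (`IsApproximateSolution.energy_inequality`). -/

namespace QuasiReversibility

/-! ### Mollification in time -/

section Mollification

variable {E F : Type*} [NormedAddCommGroup E] [NormedSpace ℝ E]
  [NormedAddCommGroup F] [NormedSpace ℝ F] {T : ℝ} {η : ℝ → ℝ}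

/-- The mollification in time, with kernel `η`, of a function on `(0, T)`. -/
noncomputable def timeMollify (T : ℝ) (η : ℝ → ℝ) (X : ℝ → E) (t : ℝ) : E :=
  ∫ s in Ioo 0 T, η (t - s) • X s

theorem timeMollify_eq_convolution (η : ℝ → ℝ) (X : ℝ → E) :
    timeMollify T η X
      = convolution η ((Ioo 0 T).indicator X) (ContinuousLinearMap.lsmul ℝ ℝ) volume := by
  funext t
  rw [convolution_lsmul_swap, timeMollify, ← integral_indicator measurableSet_Ioo]
  congr 1
  funext s
  by_cases hs : s ∈ Ioo 0 T <;> simp [hs]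

theorem integrableOn_bdd_smul {X : ℝ → E} (hX : IntegrableOn X (Ioo 0 T)) {ψ : ℝ → ℝ}
    (hψ : Continuous ψ) (hc : HasCompactSupport ψ) :
    IntegrableOn (fun s => ψ s • X s) (Ioo 0 T) := by
  obtain ⟨C, hC⟩ := hψ.bounded_above_of_compact_support hc
  exact Integrable.bdd_smul hX C hψ.aestronglyMeasurable (ae_of_all _ hC)

theorem hasCompactSupport_comp_sub (hc : HasCompactSupport η) (t : ℝ) :
    HasCompactSupport fun s => η (t - s) :=
  hc.comp_homeomorph (Homeomorph.subLeft t)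

theorem integrableOn_timeMollify {X : ℝ → E} (hX : IntegrableOn X (Ioo 0 T))
    (hη : Continuous η) (hc : HasCompactSupport η) (t : ℝ) :
    IntegrableOn (fun s => η (t - s) • X s) (Ioo 0 T) :=
  integrableOn_bdd_smul hX (hη.comp (continuous_const.sub continuous_id))
    (hasCompactSupport_comp_sub hc t)

theorem map_timeMollify [CompleteSpace E] [CompleteSpace F] (L : E →L[ℝ] F) {X : ℝ → E}
    (hX : IntegrableOn X (Ioo 0 T)) (hη : Continuous η) (hc : HasCompactSupport η) (t : ℝ) :
    L (timeMollify T η X t) = timeMollify T η (fun s => L (X s)) t := by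
  rw [timeMollify, ← L.integral_comp_comm (integrableOn_timeMollify hX hη hc t)]
  simp [timeMollify]

theorem timeMollify_congr {X Y : ℝ → E} (h : X =ᵐ[volume.restrict (Ioo 0 T)] Y) (t : ℝ) :
    timeMollify T η X t = timeMollify T η Y t := by
  apply integral_congr_ae
  filter_upwards [h] with s hs
  rw [hs]

theorem timeMollify_add {X Y : ℝ → E} (hX : IntegrableOn X (Ioo 0 T))
    (hY : IntegrableOn Y (Ioo 0 T)) (hη : Continuous η) (hc : HasCompactSupport η) (t : ℝ) :
    timeMollify T η (fun s => X s + Y s) t = timeMollify T η X t + timeMollify T η Y t := by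
  simp only [timeMollify, smul_add]
  exact integral_add (integrableOn_timeMollify hX hη hc t) (integrableOn_timeMollify hY hη hc t)

theorem timeMollify_sub {X Y : ℝ → E} (hX : IntegrableOn X (Ioo 0 T))
    (hY : IntegrableOn Y (Ioo 0 T)) (hη : Continuous η) (hc : HasCompactSupport η) (t : ℝ) :
    timeMollify T η (fun s => X s - Y s) t = timeMollify T η X t - timeMollify T η Y t := by
  simp only [timeMollify, smul_sub]
  exact integral_sub (integrableOn_timeMollify hX hη hc t) (integrableOn_timeMollify hY hη hc t)

theorem locallyIntegrable_indicator {E : Type*} [NormedAddCommGroup E] {X : ℝ → E} (hX : IntegrableOn X (Ioo 0 T)) :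
    LocallyIntegrable ((Ioo 0 T).indicator X) :=
  (hX.integrable_indicator measurableSet_Ioo).locallyIntegrable

theorem hasDerivAt_timeMollify {X : ℝ → E} (hX : IntegrableOn X (Ioo 0 T))
    (hη : ContDiff ℝ ∞ η) (hc : HasCompactSupport η) (t : ℝ) :
    HasDerivAt (timeMollify T η X) (timeMollify T (deriv η) X t) t := by
  rw [timeMollify_eq_convolution, timeMollify_eq_convolution]
  exact hc.hasDerivAt_convolution_left (ContinuousLinearMap.lsmul ℝ ℝ) (hη.of_le (by simp))
    (locallyIntegrable_indicator hX) t

theorem isTestFunction_comp_sub {δ t : ℝ} (hη : ContDiff ℝ ∞ η) (hc : HasCompactSupport η)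
    (hs : tsupport η ⊆ Metric.closedBall 0 δ) (ht : t ∈ Ioo δ (T - δ)) :
    IsTestFunction (Ioo 0 T) fun s => η (t - s) where
  smooth := hη.comp (contDiff_const.sub contDiff_id)
  compact := hasCompactSupport_comp_sub hc t
  support_subset := by
    intro s hs'
    have h1 : t - s ∈ tsupport η :=
      tsupport_comp_subset_preimage η (f := fun s => t - s) (by fun_prop) hs'
    have h2 := hs h1
    rw [mem_closedBall_zero_iff, Real.norm_eq_abs, abs_le] at h2
    exact ⟨by linarith [ht.1], by linarith [ht.2]⟩

/-- The kernel `s ↦ η (t - s)` is an admissible test function when `t` is at distance more than `δ`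
from the endpoints; its derivative carries a minus sign that cancels the one in the weak derivative.
-/
theorem timeMollify_deriv_eq {X g : ℝ → E} (hXg : HasWeakTimeDeriv T X g) {δ t : ℝ}
    (hη : ContDiff ℝ ∞ η) (hc : HasCompactSupport η)
    (hs : tsupport η ⊆ Metric.closedBall 0 δ) (ht : t ∈ Ioo δ (T - δ)) :
    timeMollify T (deriv η) X t = timeMollify T η g t := by
  have h := hXg _ (isTestFunction_comp_sub hη hc hs ht)
  have h1 : ∀ s, deriv (fun s => η (t - s)) s = - deriv η (t - s) := fun s =>
    deriv_comp_const_sub η t s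
  simp only [h1, neg_smul, integral_neg, neg_inj] at h
  exact h

theorem tendsto_timeMollify [CompleteSpace E] {φ : ℕ → ContDiffBump (0 : ℝ)} {X : ℝ → E}
    (hφ : Tendsto (fun i => (φ i).rOut) atTop (𝓝 0)) (hX : ContinuousOn X (Icc 0 T)) {t : ℝ}
    (ht : t ∈ Ioo 0 T) :
    Tendsto (fun i => timeMollify T ((φ i).normed volume) X t) atTop (𝓝 (X t)) := by
  simp only [timeMollify_eq_convolution]
  refine ContDiffBump.convolution_tendsto_right hφ (Eventually.of_forall fun _ => ?_) ?_
    tendsto_const_nhds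
  · rw [aestronglyMeasurable_indicator_iff measurableSet_Ioo]
    exact (hX.mono Ioo_subset_Icc_self).aestronglyMeasurable measurableSet_Ioo
  · refine Tendsto.comp (g := (Ioo 0 T).indicator X) ?_ tendsto_snd
    have h1 : (Ioo 0 T).indicator X =ᶠ[𝓝 t] X := by
      filter_upwards [isOpen_Ioo.mem_nhds ht] with s hs
      simp [hs]
    refine Tendsto.congr' h1.symm ?_
    exact hX.continuousAt (Icc_mem_nhds ht.1 ht.2)

/-- Lebesgue differentiation: the bounded ratio of radii keeps the kernels comparable to normalized
indicators of intervals. -/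
theorem ae_tendsto_timeMollify [CompleteSpace E] {φ : ℕ → ContDiffBump (0 : ℝ)} {X : ℝ → E} {K : ℝ}
    (hφ : Tendsto (fun i => (φ i).rOut) atTop (𝓝 0)) (hK : ∀ i, (φ i).rOut ≤ K * (φ i).rIn)
    (hX : IntegrableOn X (Ioo 0 T)) :
    ∀ᵐ t ∂volume.restrict (Ioo 0 T),
      Tendsto (fun i => timeMollify T ((φ i).normed volume) X t) atTop (𝓝 (X t)) := by
  rw [ae_restrict_iff' measurableSet_Ioo]
  filter_upwards [ContDiffBump.ae_convolution_tendsto_right_of_locallyIntegrable hφ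
    (Eventually.of_forall hK) (locallyIntegrable_indicator hX)] with t h ht
  simp only [timeMollify_eq_convolution]
  simpa [ht] using h

/-- Jensen's inequality for mollification. -/
theorem timeMollify_sq_le {r : ℝ → ℝ} (hr : MemLp r 2 (volume.restrict (Ioo 0 T)))
    (hη : Continuous η) (hc : HasCompactSupport η) (h0 : ∀ s, 0 ≤ η s) (h1 : ∫ s, η s = 1)
    (t : ℝ) : timeMollify T η r t ^ 2 ≤ timeMollify T η (fun s => r s ^ 2) t := by
  have hr1 : IntegrableOn r (Ioo 0 T) := hr.integrable (by norm_num)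
  have hr2 : IntegrableOn (fun s => r s ^ 2) (Ioo 0 T) := hr.integrable_sq
  set m := timeMollify T η r t with hm
  have hη' : Integrable fun s => η (t - s) :=
    (hη.comp (continuous_const.sub continuous_id)).integrable_of_hasCompactSupport
      (hasCompactSupport_comp_sub hc t)
  -- Only `≤ 1`, because the kernel is cut off to `(0, T)`. This suffices in the expansion of `∫ η
  -- (t - s) (r s - m)² ≥ 0`.
  have hmass : ∫ s in Ioo 0 T, η (t - s) ≤ 1 := by
    rw [← h1, ← integral_sub_left_eq_self η volume t]
    exact setIntegral_le_integral hη' (ae_of_all _ fun s => h0 _)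
  have h := integral_nonneg_of_ae (μ := volume.restrict (Ioo 0 T))
    (f := fun s => η (t - s) • (r s ^ 2) - 2 * m * (η (t - s) • r s) + m ^ 2 * η (t - s))
    (ae_of_all _ fun s => by
      have := mul_nonneg (h0 (t - s)) (sq_nonneg (r s - m))
      simp only [smul_eq_mul, Pi.zero_apply]
      nlinarith)
  rw [integral_add, integral_sub, integral_const_mul, integral_const_mul] at h
  · change 0 ≤ timeMollify T η (fun s => r s ^ 2) t - 2 * m * m + m ^ 2 * _ at h
    nlinarith [sq_nonneg m]
  · exact integrableOn_timeMollify hr2 hη hc t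
  · exact (integrableOn_timeMollify hr1 hη hc t).const_mul _
  · exact (integrableOn_timeMollify hr2 hη hc t).sub
      ((integrableOn_timeMollify hr1 hη hc t).const_mul _)
  · exact hη'.integrableOn.const_mul _

theorem continuous_timeMollify {X : ℝ → E} (hX : IntegrableOn X (Ioo 0 T))
    (hη : ContDiff ℝ ∞ η) (hc : HasCompactSupport η) : Continuous (timeMollify T η X) :=
  continuous_iff_continuousAt.2 fun t => (hasDerivAt_timeMollify hX hη hc t).continuousAt

/-- Jensen pointwise, then Fubini: a kernel of mass one preserves the total integral of `r²`. -/
theorem integral_timeMollify_sq_le {r : ℝ → ℝ} (hr : MemLp r 2 (volume.restrict (Ioo 0 T)))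
    (hη : ContDiff ℝ ∞ η) (hc : HasCompactSupport η) (h0 : ∀ s, 0 ≤ η s) (h1 : ∫ s, η s = 1)
    {a b : ℝ} (hab : a ≤ b) :
    ∫ t in a..b, timeMollify T η r t ^ 2 ≤ ∫ s in Ioo 0 T, r s ^ 2 := by
  have hr2 : IntegrableOn (fun s => r s ^ 2) (Ioo 0 T) := hr.integrable_sq
  have hη' : Integrable η := hη.continuous.integrable_of_hasCompactSupport hc
  have hint : Integrable (timeMollify T η (fun s => r s ^ 2)) := by
    rw [timeMollify_eq_convolution]
    exact hη'.integrable_convolution _ (hr2.integrable_indicator measurableSet_Ioo)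
  calc ∫ t in a..b, timeMollify T η r t ^ 2
      ≤ ∫ t in a..b, timeMollify T η (fun s => r s ^ 2) t := by
        refine intervalIntegral.integral_mono_on hab ?_ hint.intervalIntegrable fun t _ =>
          timeMollify_sq_le hr hη.continuous hc h0 h1 t
        exact ((continuous_timeMollify (hr.integrable (by norm_num)) hη hc).pow 2).intervalIntegrable
          _ _
    _ ≤ ∫ t, timeMollify T η (fun s => r s ^ 2) t := by
        rw [intervalIntegral.integral_of_le hab]
        refine setIntegral_le_integral hint (ae_of_all _ fun t => ?_)
        exact integral_nonneg fun s => mul_nonneg (h0 _) (sq_nonneg _)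
    _ = ∫ s in Ioo 0 T, r s ^ 2 := by
        rw [timeMollify_eq_convolution, integral_convolution _ hη'
          (hr2.integrable_indicator measurableSet_Ioo), h1, integral_indicator measurableSet_Ioo]
        simp

end Mollification

/-! ### The energy inequality for smooth functions -/

section SmoothEnergy

variable {V H G : Type*} [NormedAddCommGroup V] [NormedSpace ℝ V]
  [NormedAddCommGroup H] [InnerProductSpace ℝ H] [NormedAddCommGroup G] [InnerProductSpace ℝ G]

/-- The weighted energy `‖v + a w‖² + (a² - a) ‖w‖² + (a - 1) ‖∇w‖²` of a state `w` with
velocity `v`. -/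
def weightedEnergy (j : V →L[ℝ] H) (D : V →L[ℝ] G) (a : ℝ) (w : V) (v : H) : ℝ :=
  ‖v + a • j w‖ ^ 2 + (a ^ 2 - a) * ‖j w‖ ^ 2 + (a - 1) * ‖D w‖ ^ 2

/-- In terms of `p = w' + a w` the equation reads `w'' = -w' - Δp + (a - 1)Δw + P p - (a - 1) P w +
R`. The weights of the energy cancel `⟨w, p⟩` and `⟨Dw, Dp⟩` exactly, leaving only `P` and `R` to
estimate by Cauchy–Schwarz and Young. -/
theorem energy_derivative_bound {j : V →L[ℝ] H} {D : V →L[ℝ] G} {P : H →ₗ[ℝ] H} {a r : ℝ}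
    (ha : 2 ≤ a) (hP : ∀ h, ‖P h‖ ≤ a * ‖h‖) {w w' w'' : V}
    (heq : |inner ℝ (j w'') (j (w' + a • w)) + inner ℝ (j w') (j (w' + a • w))
        - inner ℝ (D w) (D (w' + a • w)) - inner ℝ (D w') (D (w' + a • w))
        - inner ℝ (P (j w)) (j (w' + a • w)) - inner ℝ (P (j w')) (j (w' + a • w))|
      ≤ r * ‖j (w' + a • w)‖) :
    2 * ‖D (w' + a • w)‖ ^ 2 - r ^ 2 ≤
      (2 * inner ℝ (j w' + a • j w) (j w'' + a • j w')
        + (a ^ 2 - a) * (2 * inner ℝ (j w) (j w')) + (a - 1) * (2 * inner ℝ (D w) (D w')))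
        + 3 * a * weightedEnergy j D a w (j w') := by
  obtain ⟨p, hp⟩ : ∃ p, p = w' + a • w := ⟨_, rfl⟩
  have hw' : w' = p - a • w := by rw [hp]; simp
  subst hw'
  simp only [sub_add_cancel] at *
  clear hp
  have h1 : |inner ℝ (P (j p)) (j p)| ≤ a * ‖j p‖ ^ 2 := by
    refine (abs_real_inner_le_norm _ _).trans ?_
    nlinarith [hP (j p), norm_nonneg (j p)]
  have h2 : |inner ℝ (P (j w)) (j p)| ≤ a * ‖j w‖ * ‖j p‖ := by
    refine (abs_real_inner_le_norm _ _).trans ?_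
    exact mul_le_mul_of_nonneg_right (hP (j w)) (norm_nonneg (j p))
  simp only [map_sub, map_smul, inner_sub_left, inner_sub_right, inner_add_right,
    real_inner_smul_left, real_inner_smul_right, weightedEnergy, sub_add_cancel,
    real_inner_self_eq_norm_sq] at heq ⊢
  rw [real_inner_comm (j w'') (j p), real_inner_comm (j p) (j w)] at *
  rw [abs_le] at h1 h2 heq
  have h3 : 2 * (a * ‖j w‖ * ‖j p‖) ≤ a ^ 2 * ‖j w‖ ^ 2 + ‖j p‖ ^ 2 := by
    nlinarith [sq_nonneg (a * ‖j w‖ - ‖j p‖)]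
  have h4 : 2 * (r * ‖j p‖) ≤ r ^ 2 + ‖j p‖ ^ 2 := by
    nlinarith [sq_nonneg (r - ‖j p‖)]
  have h5 : 0 ≤ a * (a - 1) * ‖D w‖ ^ 2 := by
    have : 0 ≤ a - 1 := by linarith
    positivity
  have h6 : 0 ≤ (a - 2) * ‖j p‖ ^ 2 := mul_nonneg (by linarith) (sq_nonneg _)
  have h7 := mul_le_mul_of_nonneg_left h3 (show 0 ≤ a - 1 by linarith)
  have h8 := mul_le_mul_of_nonneg_left h2.2 (show 0 ≤ a - 1 by linarith)
  -- The rate `3a` is dictated by `‖j w‖²`: the energy yields `-2a²(a - 1)`, the term with `P w`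
  -- costs `a²(a - 1)`, and `3a (a² - a)` balances both. The other coefficients are nonnegative.
  linarith [heq.1, h1.1]

theorem weightedEnergy_nonneg {j : V →L[ℝ] H} {D : V →L[ℝ] G} {a : ℝ} (ha : 1 ≤ a) (w : V)
    (v : H) : 0 ≤ weightedEnergy j D a w v := by
  have h1 : 0 ≤ a ^ 2 - a := by nlinarith
  have h2 : 0 ≤ a - 1 := by linarith
  unfold weightedEnergy
  positivity

/-- The backward energy inequality along smooth approximate solutions. -/
theorem energy_inequality_of_hasDerivAt {j : V →L[ℝ] H} {D : V →L[ℝ] G} {P : H →ₗ[ℝ] H}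
    {a : ℝ} (ha : 2 ≤ a) (hP : ∀ h, ‖P h‖ ≤ a * ‖h‖) {w w₁ w₂ : ℝ → V} {r : ℝ → ℝ}
    {t₀ t₁ : ℝ} (ht : t₀ ≤ t₁) (hw : ∀ t ∈ Icc t₀ t₁, HasDerivAt w (w₁ t) t)
    (hw₁ : ∀ t ∈ Icc t₀ t₁, HasDerivAt w₁ (w₂ t) t) (hr : Continuous r)
    (heq : ∀ t ∈ Icc t₀ t₁, ∀ φ : V,
      |inner ℝ (j (w₂ t)) (j φ) + inner ℝ (j (w₁ t)) (j φ)
        - inner ℝ (D (w t)) (D φ) - inner ℝ (D (w₁ t)) (D φ)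
        - inner ℝ (P (j (w t))) (j φ) - inner ℝ (P (j (w₁ t))) (j φ)| ≤ r t * ‖j φ‖) :
    weightedEnergy j D a (w t₀) (j (w₁ t₀))
        + 2 * ∫ t in t₀..t₁, ‖D (w₁ t + a • w t)‖ ^ 2
      ≤ Real.exp (3 * a * (t₁ - t₀))
        * (weightedEnergy j D a (w t₁) (j (w₁ t₁)) + ∫ t in t₀..t₁, r t ^ 2) := by
  have hwc : ContinuousOn w (Icc t₀ t₁) := fun t h => (hw t h).continuousAt.continuousWithinAt
  have hw₁c : ContinuousOn w₁ (Icc t₀ t₁) := fun t h => (hw₁ t h).continuousAt.continuousWithinAt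
  set k := Real.exp (3 * a * (t₁ - t₀)) with hk
  have hpc : ContinuousOn (fun t => ‖D (w₁ t + a • w t)‖ ^ 2) (Icc t₀ t₁) := by fun_prop
  have hE : ∀ t ∈ Icc t₀ t₁, HasDerivAt (fun t => weightedEnergy j D a (w t) (j (w₁ t)))
      (2 * inner ℝ (j (w₁ t) + a • j (w t)) (j (w₂ t) + a • j (w₁ t))
        + (a ^ 2 - a) * (2 * inner ℝ (j (w t)) (j (w₁ t)))
        + (a - 1) * (2 * inner ℝ (D (w t)) (D (w₁ t)))) t := by
    intro t h
    have hjw := j.hasFDerivAt.comp_hasDerivAt t (hw t h)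
    have hjw₁ := j.hasFDerivAt.comp_hasDerivAt t (hw₁ t h)
    have hDw := D.hasFDerivAt.comp_hasDerivAt t (hw t h)
    exact ((hjw₁.add (hjw.const_smul a)).norm_sq.add (hjw.norm_sq.const_mul _)).add
      (hDw.norm_sq.const_mul _)
  -- Integrating factor `e^{3a(t - t₀)}`; it lies between `1`, used for the gradient term, and `k`,
  -- used for the residual.
  have hexp : ∀ t, HasDerivAt (fun t => Real.exp (3 * a * (t - t₀)))
      (Real.exp (3 * a * (t - t₀)) * (3 * a)) t := fun t => by
    simpa using (((hasDerivAt_id t).sub_const t₀).const_mul (3 * a)).exp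
  have hF := fun t h => (hexp t).mul (hE t h)
  have hbound : ∀ t ∈ Ioo t₀ t₁, 2 * ‖D (w₁ t + a • w t)‖ ^ 2 - k * r t ^ 2
      ≤ Real.exp (3 * a * (t - t₀)) * (3 * a) * weightedEnergy j D a (w t) (j (w₁ t))
        + Real.exp (3 * a * (t - t₀))
          * (2 * inner ℝ (j (w₁ t) + a • j (w t)) (j (w₂ t) + a • j (w₁ t))
        + (a ^ 2 - a) * (2 * inner ℝ (j (w t)) (j (w₁ t)))
        + (a - 1) * (2 * inner ℝ (D (w t)) (D (w₁ t)))) := by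
    intro t h
    have h1 := energy_derivative_bound ha hP (heq t (Ioo_subset_Icc_self h) (w₁ t + a • w t))
    have h2 : 1 ≤ Real.exp (3 * a * (t - t₀)) :=
      Real.one_le_exp (mul_nonneg (by linarith) (by linarith [h.1]))
    have h3 : Real.exp (3 * a * (t - t₀)) ≤ k :=
      Real.exp_le_exp.2 (mul_le_mul_of_nonneg_left (by linarith [h.2]) (by linarith))
    have h4 := mul_le_mul_of_nonneg_left h1 (Real.exp_pos (3 * a * (t - t₀))).le
    have h5 := mul_le_mul_of_nonneg_right h2 (sq_nonneg ‖D (w₁ t + a • w t)‖)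
    have h6 := mul_le_mul_of_nonneg_right h3 (sq_nonneg (r t))
    linarith
  -- This form of the fundamental theorem needs integrability of the lower bound only, so no
  -- continuity of `w₂` is required.
  have key := intervalIntegral.integral_le_sub_of_hasDeriv_right_of_le ht
    (fun t h => (hF t h).continuousAt.continuousWithinAt)
    (fun t h => (hF t (Ioo_subset_Icc_self h)).hasDerivWithinAt)
    (φ := fun t => 2 * ‖D (w₁ t + a • w t)‖ ^ 2 - k * r t ^ 2)
    (((hpc.const_mul 2).sub (by fun_prop)).integrableOn_Icc) hbound
  rw [intervalIntegral.integral_sub, intervalIntegral.integral_const_mul,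
    intervalIntegral.integral_const_mul] at key
  · simp only [Pi.mul_apply, sub_self, mul_zero, Real.exp_zero, one_mul, ← hk] at key
    linarith
  · exact ((hpc.const_mul 2).mono (uIcc_of_le ht).subset).intervalIntegrable
  · exact (by fun_prop : Continuous fun t => k * r t ^ 2).intervalIntegrable _ _

end SmoothEnergy

/-! ### Integrability and limit tools -/

theorem memLp_of_continuousOn_Icc {E : Type*} [NormedAddCommGroup E] {T : ℝ} {X : ℝ → E}
    (hX : ContinuousOn X (Icc 0 T)) : MemLp X 2 (volume.restrict (Ioo 0 T)) := by
  obtain ⟨C, hC⟩ := isCompact_Icc.exists_bound_of_continuousOn hX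
  refine MemLp.of_bound ((hX.mono Ioo_subset_Icc_self).aestronglyMeasurable measurableSet_Ioo) C ?_
  filter_upwards [ae_restrict_mem measurableSet_Ioo] with t ht
  exact hC t (Ioo_subset_Icc_self ht)

theorem integrableOn_of_memLp_two {E : Type*} [NormedAddCommGroup E] {T : ℝ} {X : ℝ → E}
    (hX : MemLp X 2 (volume.restrict (Ioo 0 T))) : IntegrableOn X (Ioo 0 T) :=
  hX.integrable (by norm_num)

/-- A form of Fatou's lemma for real valued functions. -/
theorem integral_le_of_ae_tendsto {α : Type*} [MeasurableSpace α] {μ : Measure α}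
    {F : ℕ → α → ℝ} {f : α → ℝ} {B : ℕ → ℝ} {b : ℝ} (hF : ∀ᶠ n in atTop, Integrable (F n) μ)
    (hF0 : ∀ n x, 0 ≤ F n x) (hf : ∀ᵐ x ∂μ, Tendsto (fun n => F n x) atTop (𝓝 (f x)))
    (hfm : AEStronglyMeasurable f μ) (hB : ∀ᶠ n in atTop, ∫ x, F n x ∂μ ≤ B n)
    (hb : Tendsto B atTop (𝓝 b)) : ∫ x, f x ∂μ ≤ b := by
  obtain ⟨N, hN⟩ := eventually_atTop.1 (hF.and hB)
  have hf0 : 0 ≤ᵐ[μ] f := by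
    filter_upwards [hf] with x hx using ge_of_tendsto' hx fun n => hF0 n x
  have hb0 : 0 ≤ b := ge_of_tendsto hb (hB.mono fun n hn => (integral_nonneg (hF0 n)).trans hn)
  rw [integral_eq_lintegral_of_nonneg_ae hf0 hfm]
  refine ENNReal.toReal_le_of_le_ofReal hb0 ?_
  calc ∫⁻ x, ENNReal.ofReal (f x) ∂μ
      = ∫⁻ x, liminf (fun n => ENNReal.ofReal (F (n + N) x)) atTop ∂μ := by
        apply lintegral_congr_ae
        filter_upwards [hf] with x hx
        have := (ENNReal.continuous_ofReal.tendsto _).comp (hx.comp (tendsto_add_atTop_nat N))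
        exact this.liminf_eq.symm
    _ ≤ liminf (fun n => ∫⁻ x, ENNReal.ofReal (F (n + N) x) ∂μ) atTop :=
        lintegral_liminf_le' fun n => (hN (n + N) (by omega)).1.aemeasurable.ennreal_ofReal
    _ ≤ liminf (fun n => ENNReal.ofReal (B (n + N))) atTop := by
        refine liminf_le_liminf (Eventually.of_forall fun n => ?_)
        rw [← ofReal_integral_eq_lintegral_ofReal (hN (n + N) (by omega)).1
          (ae_of_all _ (hF0 _))]
        exact ENNReal.ofReal_le_ofReal (hN (n + N) (by omega)).2
    _ = ENNReal.ofReal b :=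
        ((ENNReal.continuous_ofReal.tendsto _).comp (hb.comp (tendsto_add_atTop_nat N))).liminf_eq

theorem exists_mollifiers : ∃ φ : ℕ → ContDiffBump (0 : ℝ),
    Tendsto (fun i => (φ i).rOut) atTop (𝓝 0) ∧ ∀ i, (φ i).rOut ≤ 2 * (φ i).rIn := by
  refine ⟨fun n => ⟨1 / ((n : ℝ) + 1) / 2, 1 / ((n : ℝ) + 1), by positivity, ?_⟩,
    tendsto_one_div_add_atTop_nhds_zero_nat, fun n => le_of_eq (by ring)⟩
  have : 0 < 1 / ((n : ℝ) + 1) := by positivity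
  linarith

/-- Nonnegativity of the kernel turns a bound valid almost everywhere into one valid at every time.
-/
theorem abs_timeMollify_le {T : ℝ} {q r : ℝ → ℝ} {η : ℝ → ℝ} {c : ℝ} (hη : Continuous η)
    (hc : HasCompactSupport η) (h0 : ∀ s, 0 ≤ η s) (hr : IntegrableOn r (Ioo 0 T))
    (h : ∀ᵐ t ∂volume.restrict (Ioo 0 T), |q t| ≤ r t * c) (t : ℝ) :
    |timeMollify T η q t| ≤ timeMollify T η r t * c := by
  rw [timeMollify, timeMollify, ← integral_mul_const]
  refine norm_integral_le_of_norm_le (G := ℝ) ((integrableOn_timeMollify hr hη hc t).mul_const c) ?_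
  filter_upwards [h] with s hs
  rw [norm_smul, Real.norm_of_nonneg (h0 _), smul_eq_mul, mul_assoc]
  exact mul_le_mul_of_nonneg_left hs (h0 _)

/-! ### The energy inequality for weak solutions -/

section WeakEnergy

variable {V H G : Type*} [NormedAddCommGroup V] [NormedSpace ℝ V]
  [NormedAddCommGroup H] [InnerProductSpace ℝ H]
  [NormedAddCommGroup G] [InnerProductSpace ℝ G]

/-- A solution of `w_tt + w_t + Δw + Δw_t = P w + P w_t + R` in the weak sense, where the
residual `R` is bounded by `ρ`. -/
structure IsApproximateSolution (j : V →L[ℝ] H) (D : V →L[ℝ] G) (P : H →ₗ[ℝ] H) (T : ℝ)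
    (pos : ℝ → V) (velV : ℝ → V) (vel : ℝ → H) (acc : ℝ → V → ℝ) (ρ : ℝ → ℝ) : Prop where
  continuousOn_pos : ContinuousOn pos (Icc 0 T)
  continuousOn_vel : ContinuousOn vel (Icc 0 T)
  memLp_velV : MemLp velV 2 (volume.restrict (Ioo 0 T))
  integrableOn_acc : ∀ φ, IntegrableOn (fun t => acc t φ) (Ioo 0 T)
  memLp_residual : MemLp ρ 2 (volume.restrict (Ioo 0 T))
  vel_eq : (fun t => j (velV t)) =ᵐ[volume.restrict (Ioo 0 T)] vel
  deriv_pos : HasWeakTimeDeriv T pos velV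
  deriv_vel : ∀ φ, HasWeakTimeDeriv T (fun t => (inner ℝ (vel t) (j φ) : ℝ)) fun t => acc t φ
  residual_le : ∀ φ, ∀ᵐ t ∂volume.restrict (Ioo 0 T),
    |acc t φ + inner ℝ (vel t) (j φ)
        - inner ℝ (D (pos t)) (D φ) - inner ℝ (D (velV t)) (D φ)
        - inner ℝ (P (j (pos t))) (j φ) - inner ℝ (P (vel t)) (j φ)| ≤ ρ t * ‖j φ‖

variable {j : V →L[ℝ] H} {D : V →L[ℝ] G} {P : H →ₗ[ℝ] H} {T a : ℝ} {pos velV : ℝ → V}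
  {vel : ℝ → H} {acc : ℝ → V → ℝ} {ρ : ℝ → ℝ}

/-- For each fixed `φ` the residual is a sum of continuous linear functionals of the unknowns, which
commute with mollification. The exceptional null set of times, which depends on `φ`, disappears, so
the result may be tested with a `φ` that varies with `t`. -/
theorem IsApproximateSolution.timeMollify_residual_le [CompleteSpace V] [CompleteSpace H]
    (hs : IsApproximateSolution j D P T pos velV vel acc ρ) (hP : ∀ h, ‖P h‖ ≤ a * ‖h‖)
    {η : ℝ → ℝ} {δ t : ℝ} (hη : ContDiff ℝ ∞ η) (hc : HasCompactSupport η)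
    (h0 : ∀ s, 0 ≤ η s) (hsupp : tsupport η ⊆ Metric.closedBall 0 δ) (ht : t ∈ Ioo δ (T - δ))
    (φ : V) :
    |inner ℝ (j (timeMollify T (deriv η) velV t)) (j φ) + inner ℝ (j (timeMollify T η velV t)) (j φ)
        - inner ℝ (D (timeMollify T η pos t)) (D φ) - inner ℝ (D (timeMollify T η velV t)) (D φ)
        - inner ℝ (P (j (timeMollify T η pos t))) (j φ)
        - inner ℝ (P (j (timeMollify T η velV t))) (j φ)|
      ≤ timeMollify T η ρ t * ‖j φ‖ := by
  have hpos := integrableOn_of_memLp_two (memLp_of_continuousOn_Icc hs.continuousOn_pos)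
  have hvel := integrableOn_of_memLp_two (memLp_of_continuousOn_Icc hs.continuousOn_vel)
  have hvelV := integrableOn_of_memLp_two hs.memLp_velV
  have hη' : Continuous (deriv η) := hη.continuous_deriv (by simp)
  let P' : H →L[ℝ] H := P.mkContinuous a hP
  let ℓ : H →L[ℝ] ℝ := innerSL ℝ (j φ)
  let m : G →L[ℝ] ℝ := innerSL ℝ (D φ)
  let L₁ : H →L[ℝ] ℝ := ℓ - ℓ.comp P'
  let L₂ : V →L[ℝ] ℝ := m.comp D + (ℓ.comp P').comp j
  let L₃ : V →L[ℝ] ℝ := m.comp D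
  have hvelη : j (timeMollify T η velV t) = timeMollify T η vel t := by
    rw [map_timeMollify j hvelV hη.continuous hc, timeMollify_congr hs.vel_eq]
  have hvelη' : j (timeMollify T (deriv η) velV t) = timeMollify T (deriv η) vel t := by
    rw [map_timeMollify j hvelV hη' hc.deriv, timeMollify_congr hs.vel_eq]
  -- The derivative on the kernel is transferred to `⟨vel, j φ⟩`, whose weak derivative is `acc`;
  -- the mollified velocity thus has a `V`-valued derivative although `acc` acts only on test
  -- vectors.
  have hacc : inner ℝ (j (timeMollify T (deriv η) velV t)) (j φ)
      = timeMollify T η (fun s => acc s φ) t := by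
    rw [hvelη', real_inner_comm]
    change ℓ _ = _
    rw [map_timeMollify ℓ hvel hη' hc.deriv,
      ← timeMollify_deriv_eq (hs.deriv_vel φ) hη hc hsupp ht]
    simp only [ℓ, innerSL_apply_apply, real_inner_comm]
  have h := abs_timeMollify_le (T := T) (c := ‖j φ‖) hη.continuous hc h0
    (integrableOn_of_memLp_two hs.memLp_residual)
    (q := fun s => acc s φ + L₁ (vel s) - L₂ (pos s) - L₃ (velV s)) (by
      filter_upwards [hs.residual_le φ] with s hs
      convert hs using 2
      simp only [L₁, L₂, L₃, ℓ, m, P', sub_apply, add_apply,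
        ContinuousLinearMap.comp_apply, innerSL_apply_apply, LinearMap.mkContinuous_apply]
      rw [real_inner_comm (vel s), real_inner_comm (D (pos s)), real_inner_comm (D (velV s)),
        real_inner_comm (P (vel s)), real_inner_comm (P (j (pos s)))]
      ring) t
  have i₁ := L₁.integrable_comp hvel
  have i₂ := L₂.integrable_comp hpos
  have i₃ := L₃.integrable_comp hvelV
  rw [timeMollify_sub (X := fun s => acc s φ + L₁ (vel s) - L₂ (pos s))
      (((hs.integrableOn_acc φ).add i₁).sub i₂) i₃ hη.continuous hc,
    timeMollify_sub (X := fun s => acc s φ + L₁ (vel s)) ((hs.integrableOn_acc φ).add i₁) i₂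
      hη.continuous hc,
    timeMollify_add (hs.integrableOn_acc φ) i₁ hη.continuous hc,
    ← map_timeMollify L₁ hvel hη.continuous hc, ← map_timeMollify L₂ hpos hη.continuous hc,
    ← map_timeMollify L₃ hvelV hη.continuous hc, ← hacc, ← hvelη] at h
  convert h using 2
  simp only [L₁, L₂, L₃, ℓ, m, P', sub_apply, add_apply,
    ContinuousLinearMap.comp_apply, innerSL_apply_apply, LinearMap.mkContinuous_apply]
  simp only [real_inner_comm (j φ), real_inner_comm (D φ)]
  ring

theorem IsApproximateSolution.integrableOn_gradient
    (hs : IsApproximateSolution j D P T pos velV vel acc ρ) :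
    IntegrableOn (fun t => ‖D (velV t + a • pos t)‖ ^ 2) (Ioo 0 T) :=
  (D.comp_memLp' (hs.memLp_velV.add
    ((memLp_of_continuousOn_Icc hs.continuousOn_pos).const_smul a))).integrable_norm_pow (by simp)

theorem IsApproximateSolution.energy_inequality_interior [CompleteSpace V] [CompleteSpace H]
    (hs : IsApproximateSolution j D P T pos velV vel acc ρ) (ha : 2 ≤ a)
    (hP : ∀ h, ‖P h‖ ≤ a * ‖h‖) {t₀ t₁ : ℝ} (h0 : 0 < t₀) (h01 : t₀ ≤ t₁) (h1 : t₁ < T) :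
    weightedEnergy j D a (pos t₀) (vel t₀) + 2 * ∫ t in t₀..t₁, ‖D (velV t + a • pos t)‖ ^ 2
      ≤ Real.exp (3 * a * (t₁ - t₀))
        * (weightedEnergy j D a (pos t₁) (vel t₁) + ∫ t in Ioo 0 T, ρ t ^ 2) := by
  obtain ⟨φ, hφ, hφ'⟩ := exists_mollifiers
  have hpos := integrableOn_of_memLp_two (memLp_of_continuousOn_Icc hs.continuousOn_pos)
  have hvelV := integrableOn_of_memLp_two hs.memLp_velV
  have hρ := integrableOn_of_memLp_two hs.memLp_residual
  let η : ℕ → ℝ → ℝ := fun n => (φ n).normed volume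
  let w : ℕ → ℝ → V := fun n => timeMollify T (η n) pos
  let w₁ : ℕ → ℝ → V := fun n => timeMollify T (η n) velV
  have hη : ∀ n, ContDiff ℝ ∞ (η n) := fun n => (φ n).contDiff_normed
  have hc : ∀ n, HasCompactSupport (η n) := fun n => (φ n).hasCompactSupport_normed
  have hη0 : ∀ n s, 0 ≤ η n s := fun n => (φ n).nonneg_normed
  have hη1 : ∀ n, ∫ s, η n s = 1 := fun n => (φ n).integral_normed
  have hwc : ∀ n, Continuous (w n) := fun n => continuous_timeMollify hpos (hη n) (hc n)
  have hw₁c : ∀ n, Continuous (w₁ n) := fun n => continuous_timeMollify hvelV (hη n) (hc n)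
  have hsub : Ioc t₀ t₁ ⊆ Ioo 0 T := fun t ht => ⟨h0.trans ht.1, ht.2.trans_lt h1⟩
  have hE : ∀ t ∈ Ioo 0 T, Tendsto (fun n => weightedEnergy j D a (w n t) (j (w₁ n t))) atTop
      (𝓝 (weightedEnergy j D a (pos t) (vel t))) := by
    intro t ht
    have hw := tendsto_timeMollify hφ hs.continuousOn_pos ht
    have hv := tendsto_timeMollify hφ hs.continuousOn_vel ht
    have hv' : Tendsto (fun n => j (w₁ n t)) atTop (𝓝 (vel t)) := by
      refine hv.congr fun n => ?_
      change _ = j (timeMollify T (η n) velV t)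
      rw [map_timeMollify j hvelV (hη n).continuous (hc n), timeMollify_congr hs.vel_eq]
    have hjw := (j.continuous.tendsto _).comp hw
    have hDw := (D.continuous.tendsto _).comp hw
    exact (((hv'.add (hjw.const_smul a)).norm.pow 2).add ((hjw.norm.pow 2).const_mul _)).add
      ((hDw.norm.pow 2).const_mul _)
  have hineq : ∀ᶠ n in atTop, weightedEnergy j D a (w n t₀) (j (w₁ n t₀))
      + 2 * ∫ t in t₀..t₁, ‖D (w₁ n t + a • w n t)‖ ^ 2
      ≤ Real.exp (3 * a * (t₁ - t₀)) * (weightedEnergy j D a (w n t₁) (j (w₁ n t₁))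
          + ∫ t in Ioo 0 T, ρ t ^ 2) := by
    filter_upwards [hφ.eventually (gt_mem_nhds h0),
      hφ.eventually (gt_mem_nhds (sub_pos.2 h1))] with n hn hn'
    have hsupp : tsupport (η n) ⊆ Metric.closedBall 0 (φ n).rOut :=
      ((φ n).tsupport_normed_eq (μ := volume)).subset
    have hmem : ∀ t ∈ Icc t₀ t₁, t ∈ Ioo (φ n).rOut (T - (φ n).rOut) := fun t ht =>
      ⟨hn.trans_le ht.1, by linarith [ht.2]⟩
    refine (energy_inequality_of_hasDerivAt (r := timeMollify T (η n) ρ)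
      (w₂ := timeMollify T (deriv (η n)) velV) ha hP h01 (fun t ht => ?_) (fun t _ => ?_) ?_
      (fun t ht => hs.timeMollify_residual_le hP (hη n) (hc n) (hη0 n) hsupp (hmem t ht))).trans ?_
    · rw [← timeMollify_deriv_eq hs.deriv_pos (hη n) (hc n) hsupp (hmem t ht)]
      exact hasDerivAt_timeMollify hpos (hη n) (hc n) t
    · exact hasDerivAt_timeMollify hvelV (hη n) (hc n) t
    · exact continuous_timeMollify hρ (hη n) (hc n)
    · refine mul_le_mul_of_nonneg_left ?_ (Real.exp_pos _).le
      gcongr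
      exact integral_timeMollify_sq_le hs.memLp_residual (hη n) (hc n) (hη0 n) (hη1 n) h01
  -- The energies converge at `t₀` and `t₁` by continuity of `pos` and `vel`, but the gradients of
  -- the velocity converge only almost everywhere, so their integral passes to the limit by Fatou.
  have hfatou : ∫ t in t₀..t₁, ‖D (velV t + a • pos t)‖ ^ 2
      ≤ (Real.exp (3 * a * (t₁ - t₀)) * (weightedEnergy j D a (pos t₁) (vel t₁)
          + ∫ t in Ioo 0 T, ρ t ^ 2) - weightedEnergy j D a (pos t₀) (vel t₀)) / 2 := by
    rw [intervalIntegral.integral_of_le h01]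
    refine integral_le_of_ae_tendsto (F := fun n t => ‖D (w₁ n t + a • w n t)‖ ^ 2)
      (B := fun n => (Real.exp (3 * a * (t₁ - t₀)) * (weightedEnergy j D a (w n t₁) (j (w₁ n t₁))
          + ∫ t in Ioo 0 T, ρ t ^ 2) - weightedEnergy j D a (w n t₀) (j (w₁ n t₀))) / 2)
      (Eventually.of_forall fun n => ?_) (fun n t => sq_nonneg _) ?_ ?_ ?_ ?_
    · have hw₁c := hw₁c n
      have hwc := hwc n
      exact (by fun_prop : Continuous fun t => ‖D (w₁ n t + a • w n t)‖ ^ 2).integrableOn_Ioc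
    · have h1 := ae_mono (Measure.restrict_mono hsub le_rfl) (ae_tendsto_timeMollify hφ hφ' hpos)
      have h2 := ae_mono (Measure.restrict_mono hsub le_rfl) (ae_tendsto_timeMollify hφ hφ' hvelV)
      filter_upwards [h1, h2] with t h1 h2
      exact (((D.continuous.tendsto _).comp (h2.add (h1.const_smul a))).norm).pow 2
    · exact (hs.integrableOn_gradient.mono_set hsub).aestronglyMeasurable
    · filter_upwards [hineq] with n hn
      rw [intervalIntegral.integral_of_le h01] at hn
      linarith
    · exact ((((hE t₁ ⟨h0.trans_le h01, h1⟩).add_const _).const_mul _).sub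
        (hE t₀ ⟨h0, h01.trans_lt h1⟩)).div_const 2
  linarith

/-- The backward energy inequality for weak solutions. -/
theorem IsApproximateSolution.energy_inequality [CompleteSpace V] [CompleteSpace H]
    (hs : IsApproximateSolution j D P T pos velV vel acc ρ) (hT : 0 < T) (ha : 2 ≤ a)
    (hP : ∀ h, ‖P h‖ ≤ a * ‖h‖) {t : ℝ} (ht : t ∈ Icc 0 T) :
    weightedEnergy j D a (pos t) (vel t) + 2 * ∫ s in t..T, ‖D (velV s + a • pos s)‖ ^ 2
      ≤ Real.exp (3 * a * (T - t))
        * (weightedEnergy j D a (pos T) (vel T) + ∫ s in Ioo 0 T, ρ s ^ 2) := by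
  have hpc := hs.continuousOn_pos
  have hvc := hs.continuousOn_vel
  have hE : ContinuousOn (fun t => weightedEnergy j D a (pos t) (vel t)) (Icc 0 T) := by
    unfold weightedEnergy
    fun_prop
  have hI : IntegrableOn (fun t => ‖D (velV t + a • pos t)‖ ^ 2) (Icc 0 T) :=
    (integrableOn_Icc_iff_integrableOn_Ioo (by simp) (by simp)).2 hs.integrableOn_gradient
  -- First `t₁ → T` with `t₀ > 0` fixed, then `t₀ → 0`; both sides are continuous in the moving
  -- endpoint.
  have hleft : ∀ t₀ ∈ Ioo 0 T,
      weightedEnergy j D a (pos t₀) (vel t₀) + 2 * ∫ s in t₀..T, ‖D (velV s + a • pos s)‖ ^ 2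
      ≤ Real.exp (3 * a * (T - t₀))
        * (weightedEnergy j D a (pos T) (vel T) + ∫ s in Ioo 0 T, ρ s ^ 2) := by
    intro t₀ ht₀
    have hcl : closure (Ico t₀ T) = Icc t₀ T := closure_Ico ht₀.2.ne
    have hsub : Icc t₀ T ⊆ Icc 0 T := Icc_subset_Icc_left ht₀.1.le
    refine le_on_closure (s := Ico t₀ T) (x := T)
      (f := fun t₁ => weightedEnergy j D a (pos t₀) (vel t₀)
        + 2 * ∫ s in t₀..t₁, ‖D (velV s + a • pos s)‖ ^ 2)
      (g := fun t₁ => Real.exp (3 * a * (t₁ - t₀))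
        * (weightedEnergy j D a (pos t₁) (vel t₁) + ∫ s in Ioo 0 T, ρ s ^ 2))
      (fun t₁ ht₁ => hs.energy_inequality_interior ha hP ht₀.1 ht₁.1 ht₁.2) ?_ ?_
      (by rw [hcl]; exact right_mem_Icc.2 ht₀.2.le)
    · rw [hcl]
      have := intervalIntegral.continuousOn_primitive_interval (a := t₀) (b := T)
        (by rw [uIcc_of_le ht₀.2.le]; exact hI.mono_set hsub)
      rw [uIcc_of_le ht₀.2.le] at this
      exact continuousOn_const.add (continuousOn_const.mul this)
    · rw [hcl]
      have := hE.mono hsub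
      fun_prop
  rcases ht.2.eq_or_lt with rfl | htT
  · simpa using integral_nonneg fun s => sq_nonneg (ρ s)
  have hcl : closure (Ioo 0 T) = Icc 0 T := closure_Ioo hT.ne
  refine le_on_closure (s := Ioo 0 T) (x := t)
    (f := fun t => weightedEnergy j D a (pos t) (vel t)
      + 2 * ∫ s in t..T, ‖D (velV s + a • pos s)‖ ^ 2)
    (g := fun t => Real.exp (3 * a * (T - t))
      * (weightedEnergy j D a (pos T) (vel T) + ∫ s in Ioo 0 T, ρ s ^ 2)) hleft ?_ ?_ (by rwa [hcl])
  · rw [hcl]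
    have := intervalIntegral.continuousOn_primitive_interval_left (a := 0) (b := T)
      (by rw [uIcc_of_le hT.le]; exact hI)
    rw [uIcc_of_le hT.le] at this
    exact hE.add (continuousOn_const.mul this)
  · rw [hcl]
    fun_prop

end WeakEnergy

/-! ### Weak derivatives in time -/

section WeakDerivative

variable {E F : Type*} [NormedAddCommGroup E] [NormedSpace ℝ E]
  [NormedAddCommGroup F] [NormedSpace ℝ F] {T : ℝ}

theorem IsTestFunction.integrableOn_smul {X : ℝ → E} (hX : IntegrableOn X (Ioo 0 T)) {ψ : ℝ → ℝ}
    (hψ : IsTestFunction (Ioo 0 T) ψ) : IntegrableOn (fun s => ψ s • X s) (Ioo 0 T) :=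
  integrableOn_bdd_smul hX hψ.smooth.continuous hψ.compact

theorem IsTestFunction.integrableOn_deriv_smul {X : ℝ → E} (hX : IntegrableOn X (Ioo 0 T))
    {ψ : ℝ → ℝ} (hψ : IsTestFunction (Ioo 0 T) ψ) :
    IntegrableOn (fun s => deriv ψ s • X s) (Ioo 0 T) :=
  integrableOn_bdd_smul hX (hψ.smooth.continuous_deriv (by simp)) hψ.compact.deriv

theorem HasWeakTimeDeriv.map [CompleteSpace E] [CompleteSpace F] (L : E →L[ℝ] F) {X g : ℝ → E}
    (h : HasWeakTimeDeriv T X g) (hX : IntegrableOn X (Ioo 0 T)) (hg : IntegrableOn g (Ioo 0 T)) :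
    HasWeakTimeDeriv T (fun t => L (X t)) fun t => L (g t) := by
  intro ψ hψ
  simp only [← map_smul]
  rw [L.integral_comp_comm (hψ.integrableOn_deriv_smul hX),
    L.integral_comp_comm (hψ.integrableOn_smul hg), h ψ hψ, map_neg]

theorem HasWeakTimeDeriv.sub {X Y g k : ℝ → E} (h : HasWeakTimeDeriv T X g)
    (h' : HasWeakTimeDeriv T Y k) (hX : IntegrableOn X (Ioo 0 T)) (hY : IntegrableOn Y (Ioo 0 T))
    (hg : IntegrableOn g (Ioo 0 T)) (hk : IntegrableOn k (Ioo 0 T)) :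
    HasWeakTimeDeriv T (fun t => X t - Y t) fun t => g t - k t := by
  intro ψ hψ
  simp only [smul_sub]
  rw [integral_sub (hψ.integrableOn_deriv_smul hX) (hψ.integrableOn_deriv_smul hY),
    integral_sub (hψ.integrableOn_smul hg) (hψ.integrableOn_smul hk), h ψ hψ, h' ψ hψ]
  abel

theorem HasWeakTimeDeriv.ae_unique [CompleteSpace E] {X g k : ℝ → E} (h : HasWeakTimeDeriv T X g)
    (h' : HasWeakTimeDeriv T X k) (hg : IntegrableOn g (Ioo 0 T))
    (hk : IntegrableOn k (Ioo 0 T)) : g =ᵐ[volume.restrict (Ioo 0 T)] k := by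
  have hgk : IntegrableOn (fun t => g t - k t) (Ioo 0 T) := hg.sub hk
  have := isOpen_Ioo.ae_eq_zero_of_integral_contDiff_smul_eq_zero (μ := volume)
    hgk.locallyIntegrableOn fun ψ h1 h2 h3 => by
      have hψ : IsTestFunction (Ioo 0 T) ψ := ⟨h1, h2, h3⟩
      rw [← setIntegral_eq_integral_of_forall_compl_eq_zero (s := Ioo 0 T) fun t ht => by
        rw [image_eq_zero_of_notMem_tsupport fun h => ht (h3 h), zero_smul]]
      simp only [smul_sub]
      rw [integral_sub (hψ.integrableOn_smul hg) (hψ.integrableOn_smul hk), sub_eq_zero,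
        ← neg_inj, ← h ψ hψ, ← h' ψ hψ]
  rw [EventuallyEq, ae_restrict_iff' measurableSet_Ioo]
  filter_upwards [this] with t ht hT
  exact sub_eq_zero.1 (ht hT)

end WeakDerivative

/-! ### The difference of two trajectories in `H¹₀(Ω)` -/

section Sobolev

variable {d : ℕ} {Ω : Set (Eu d)} {T : ℝ}

instance (Ω : Set (Eu d)) : CompleteSpace (H10 Ω) :=
  (Submodule.isClosed_topologicalClosure _).completeSpace_coe

/-- The embedding of `H¹₀(Ω)` into `L²(Ω)`. -/
noncomputable def H10.val : H10 Ω →L[ℝ] L2 Ω := H1.val.comp (H10 Ω).subtypeL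

/-- The weak gradient on `H¹₀(Ω)`. -/
noncomputable def H10.grad : H10 Ω →L[ℝ] L2Vec Ω := H1.grad.comp (H10 Ω).subtypeL

theorem H1.norm_sq_eq (f : H1 Ω) : ‖f‖ ^ 2 = ‖H1.val f‖ ^ 2 + ‖H1.grad f‖ ^ 2 :=
  WithLp.prod_norm_sq_eq_of_L2 (f : gradientGraph Ω).1

/-- The velocity of a trajectory as an `H¹₀(Ω)`-valued function. -/
noncomputable def Trajectory.velH10 (y : Trajectory Ω T) (t : ℝ) : H10 Ω :=
  (H10 Ω).orthogonalProjectionOnto (y.velH1 t)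

theorem Trajectory.integrableOn_pos (y : Trajectory Ω T) : IntegrableOn y.pos (Ioo 0 T) :=
  integrableOn_of_memLp_two (memLp_of_continuousOn_Icc y.continuousOn_pos)

theorem Trajectory.memLp_velH10 (y : Trajectory Ω T) :
    MemLp y.velH10 2 (volume.restrict (Ioo 0 T)) :=
  ContinuousLinearMap.comp_memLp' _ y.memLp_velH1

/-- The projection onto `H¹₀` fixes `pos` and commutes with weak differentiation. By uniqueness the
velocity is then `H¹₀`-valued, which makes `w_t + a w` an admissible test function. -/
theorem Trajectory.deriv_pos_H10 (y : Trajectory Ω T) : HasWeakTimeDeriv T y.pos y.velH10 := by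
  have := y.deriv_pos.map (H10 Ω).orthogonalProjectionOnto
    ((H10 Ω).subtypeL.integrable_comp y.integrableOn_pos) (integrableOn_of_memLp_two y.memLp_velH1)
  simp only [Submodule.orthogonalProjectionOnto_mem_subspace_eq_self] at this
  exact this

theorem Trajectory.velH1_eq (y : Trajectory Ω T) :
    ∀ᵐ t ∂volume.restrict (Ioo 0 T), y.velH1 t = y.velH10 t :=
  y.deriv_pos.ae_unique
    (y.deriv_pos_H10.map (H10 Ω).subtypeL y.integrableOn_pos
      (integrableOn_of_memLp_two y.memLp_velH10))
    (integrableOn_of_memLp_two y.memLp_velH1)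
    ((H10 Ω).subtypeL.integrable_comp (integrableOn_of_memLp_two y.memLp_velH10))

theorem Trajectory.integrableOn_acc (y : Trajectory Ω T) (φ : H10 Ω) :
    IntegrableOn (fun t => y.acc t φ) (Ioo 0 T) :=
  (ContinuousLinearMap.apply ℝ ℝ φ).integrable_comp (integrableOn_of_memLp_two y.memLp_acc)

theorem Trajectory.integrableOn_inner_vel (y : Trajectory Ω T) (h : L2 Ω) :
    IntegrableOn (fun t => (inner ℝ (y.vel t) h : ℝ)) (Ioo 0 T) :=
  integrableOn_of_memLp_two
    (memLp_of_continuousOn_Icc (y.continuousOn_vel.inner continuousOn_const))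

theorem Trajectory.deriv_vel_apply (y : Trajectory Ω T) (φ : H10 Ω) :
    HasWeakTimeDeriv T (fun t => (inner ℝ (y.vel t) (H10.val φ) : ℝ)) fun t => y.acc t φ := by
  have hc : ContinuousOn (fun t => toHneg1 (y.vel t)) (Icc 0 T) := by
    have h : Continuous fun f : L2 Ω => toHneg1 f :=
      (ContinuousLinearMap.precomp ℝ (H1.val.comp (H10 Ω).subtypeL)).continuous.comp
        (innerSL ℝ).continuous
    exact h.comp_continuousOn y.continuousOn_vel
  exact y.deriv_vel.map (ContinuousLinearMap.apply ℝ ℝ φ)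
    (integrableOn_of_memLp_two (memLp_of_continuousOn_Icc hc))
    (integrableOn_of_memLp_two y.memLp_acc)

/-- On functions coming from `W`, `P_ε` is `2Δ` up to `Q_ε`, which is of order `1 / γ(ε)`. -/
theorem IsPerturbing.abs_inner_le {W : Type*} [NormedAddCommGroup W] [NormedSpace ℝ W]
    {ι : W →ₗ[ℝ] L2 Ω} {γ : ℝ → ℝ} {C₀ : ℝ} {P : ℝ → L2 Ω →ₗ[ℝ] L2 Ω}
    {Q : ℝ → L2 Ω →ₗ.[ℝ] L2 Ω} (hQ : IsPerturbing ι γ C₀ Q) (hPQ : IsLaplacePerturbation P Q)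
    {ε : ℝ} (hε : ε ∈ Ioo (0 : ℝ) 1) {h : H10 Ω} {w : W} (hw : ι w = H10.val h) (φ : H10 Ω) :
    |(inner ℝ (P ε (H10.val h)) (H10.val φ) : ℝ) + 2 * inner ℝ (H10.grad h) (H10.grad φ)|
      ≤ C₀ / γ ε * ‖w‖ * ‖H10.val φ‖ := by
  obtain ⟨hd, hq⟩ := hQ ε hε w
  have hd' : H10.val h ∈ (Q ε).domain := hw ▸ hd
  have he : (⟨ι w, hd⟩ : (Q ε).domain) = ⟨H10.val h, hd'⟩ := Subtype.ext hw
  have hP : (inner ℝ (P ε (H10.val h)) (H10.val φ) : ℝ)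
      = -2 * inner ℝ (H10.grad h) (H10.grad φ) + inner ℝ (Q ε ⟨H10.val h, hd'⟩) (H10.val φ) :=
    hPQ ε hε h hd' φ
  rw [hP, ← he]
  calc _ = |(inner ℝ (Q ε ⟨ι w, hd⟩) (H10.val φ) : ℝ)| := by ring_nf
    _ ≤ _ := (abs_real_inner_le_norm _ _).trans
        (mul_le_mul_of_nonneg_right (hq.trans_eq (by ring)) (norm_nonneg _))

/-- The difference of a solution of the regularized problem and of the original one solves the
regularized equation up to a residual of size `1 / γ(ε)`. -/
theorem isApproximateSolution_sub {W : Type*} [NormedAddCommGroup W] [NormedSpace ℝ W]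
    {ι : W →ₗ[ℝ] L2 Ω} {γ : ℝ → ℝ} {C₀ : ℝ} {P : ℝ → L2 Ω →ₗ[ℝ] L2 Ω}
    {Q : ℝ → L2 Ω →ₗ.[ℝ] L2 Ω} (hQ : IsPerturbing ι γ C₀ Q) (hPQ : IsLaplacePerturbation P Q)
    {ε : ℝ} (hε : ε ∈ Ioo (0 : ℝ) 1) {y u : Trajectory Ω T} (hy : IsRegularizedSolution (P ε) y)
    (hu : IsExactSolution u) {U Z : ℝ → W} (hU : ContinuousOn U (Icc 0 T))
    (hUu : ∀ t ∈ Icc 0 T, ι (U t) = H1.val (u.pos t : H1 Ω))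
    (hZ : MemLp Z 2 (volume.restrict (Ioo 0 T)))
    (hZu : ∀ᵐ t ∂volume.restrict (Ioo 0 T), ι (Z t) = u.vel t) :
    IsApproximateSolution H10.val H10.grad (P ε) T (fun t => y.pos t - u.pos t)
      (fun t => y.velH10 t - u.velH10 t) (fun t => y.vel t - u.vel t)
      (fun t φ => y.acc t φ - u.acc t φ) (fun t => C₀ / γ ε * (‖U t‖ + ‖Z t‖)) where
  continuousOn_pos := y.continuousOn_pos.sub u.continuousOn_pos
  continuousOn_vel := y.continuousOn_vel.sub u.continuousOn_vel
  memLp_velV := y.memLp_velH10.sub u.memLp_velH10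
  integrableOn_acc φ := (y.integrableOn_acc φ).sub (u.integrableOn_acc φ)
  memLp_residual := ((memLp_of_continuousOn_Icc hU).norm.add hZ.norm).const_mul _
  vel_eq := by
    filter_upwards [y.vel_eq, y.velH1_eq, u.vel_eq, u.velH1_eq] with t h1 h2 h3 h4
    rw [map_sub, h1, h2, h3, h4]
    rfl
  deriv_pos := y.deriv_pos_H10.sub u.deriv_pos_H10 y.integrableOn_pos u.integrableOn_pos
    (integrableOn_of_memLp_two y.memLp_velH10) (integrableOn_of_memLp_two u.memLp_velH10)
  deriv_vel φ := by
    simp only [inner_sub_left]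
    exact (y.deriv_vel_apply φ).sub (u.deriv_vel_apply φ) (y.integrableOn_inner_vel _)
      (u.integrableOn_inner_vel _) (y.integrableOn_acc φ) (u.integrableOn_acc φ)
  residual_le φ := by
    filter_upwards [hy φ, hu φ, y.velH1_eq, u.velH1_eq, u.vel_eq, hZu,
      ae_restrict_mem measurableSet_Ioo] with t h1 h2 h3 h4 h5 h6 ht
    rw [h3] at h1
    rw [h4] at h2 h5
    -- Used for `u` and for `u_t`: the terms `2⟨∇·, ∇φ⟩` reverse the signs of the gradient terms in
    -- the original equation.
    have h7 := hQ.abs_inner_le hPQ hε (hUu t (Ioo_subset_Icc_self ht)) φ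
    have h8 := hQ.abs_inner_le hPQ hε (h6.trans h5) φ
    rw [show H10.val (u.velH10 t) = u.vel t from h5.symm] at h8
    change y.acc t φ + inner ℝ (y.vel t) (H10.val φ)
      - inner ℝ (H10.grad (y.pos t)) (H10.grad φ) - inner ℝ (H10.grad (y.velH10 t)) (H10.grad φ)
      = inner ℝ (P ε (H10.val (y.pos t))) (H10.val φ) + inner ℝ (P ε (y.vel t)) (H10.val φ) at h1
    change u.acc t φ + inner ℝ (u.vel t) (H10.val φ)
      + inner ℝ (H10.grad (u.pos t)) (H10.grad φ) + inner ℝ (H10.grad (u.velH10 t)) (H10.grad φ)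
      = 0 at h2
    simp only [map_sub, inner_sub_left]
    rw [abs_le] at h7 h8 ⊢
    constructor <;> linarith [h7.1, h7.2, h8.1, h8.2]

end Sobolev

/-! ### From the energy to the norms -/

section Estimates

variable {V H G : Type*} [NormedAddCommGroup V] [NormedSpace ℝ V]
  [NormedAddCommGroup H] [InnerProductSpace ℝ H] [NormedAddCommGroup G] [InnerProductSpace ℝ G]
  {j : V →L[ℝ] H} {D : V →L[ℝ] G} {P : H →ₗ[ℝ] H} {T a : ℝ}

/-- For `a ≥ 2` one has `2(a² - a) ≥ a²`. -/
theorem sq_mul_norm_le_weightedEnergy (ha : 2 ≤ a) (w : V) (v : H) :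
    a ^ 2 * ‖j w‖ ^ 2 ≤ 2 * weightedEnergy j D a w v := by
  have h1 : 0 ≤ (a ^ 2 - 2 * a) * ‖j w‖ ^ 2 := mul_nonneg (by nlinarith) (sq_nonneg _)
  have h2 : 0 ≤ (a - 1) * ‖D w‖ ^ 2 := mul_nonneg (by linarith) (sq_nonneg _)
  have h3 := sq_nonneg ‖v + a • j w‖
  unfold weightedEnergy
  linarith

theorem mul_norm_grad_le_weightedEnergy (ha : 2 ≤ a) (w : V) (v : H) :
    a * ‖D w‖ ^ 2 ≤ 2 * weightedEnergy j D a w v := by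
  have h1 : 0 ≤ (a ^ 2 - a) * ‖j w‖ ^ 2 := mul_nonneg (by nlinarith) (sq_nonneg _)
  have h2 : 0 ≤ (a - 2) * ‖D w‖ ^ 2 := mul_nonneg (by linarith) (sq_nonneg _)
  have h3 := sq_nonneg ‖v + a • j w‖
  unfold weightedEnergy
  linarith

theorem norm_sub_sq_le_two_mul {E : Type*} [NormedAddCommGroup E] (x y : E) :
    ‖x - y‖ ^ 2 ≤ 2 * ‖x‖ ^ 2 + 2 * ‖y‖ ^ 2 := by
  nlinarith [norm_sub_le x y, norm_nonneg (x - y), sq_nonneg (‖x‖ - ‖y‖), norm_nonneg x,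
    norm_nonneg y]

theorem norm_vel_sq_le_weightedEnergy (ha : 2 ≤ a) (w : V) (v : H) :
    ‖v‖ ^ 2 ≤ 6 * weightedEnergy j D a w v := by
  have h1 : ‖v‖ ^ 2 ≤ 2 * ‖v + a • j w‖ ^ 2 + 2 * (a ^ 2 * ‖j w‖ ^ 2) := by
    have := norm_sub_sq_le_two_mul (v + a • j w) (a • j w)
    rwa [add_sub_cancel_right, norm_smul a, mul_pow, Real.norm_eq_abs, sq_abs] at this
  have h2 := sq_mul_norm_le_weightedEnergy (j := j) (D := D) ha w v
  have h3 : ‖v + a • j w‖ ^ 2 ≤ weightedEnergy j D a w v := by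
    have h4 : 0 ≤ (a ^ 2 - a) * ‖j w‖ ^ 2 := mul_nonneg (by nlinarith) (sq_nonneg _)
    have h5 : 0 ≤ (a - 1) * ‖D w‖ ^ 2 := mul_nonneg (by linarith) (sq_nonneg _)
    unfold weightedEnergy
    linarith
  linarith

theorem integral_exp_mul_sub_le (t : ℝ) :
    3 * a * ∫ s in t..T, Real.exp (3 * a * (T - s)) ≤ Real.exp (3 * a * (T - t)) := by
  have h : ∀ s, HasDerivAt (fun s => -Real.exp (3 * a * (T - s)))
      (3 * a * Real.exp (3 * a * (T - s))) s := fun s => by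
    exact ((((hasDerivAt_id' s).const_sub T).const_mul (3 * a)).exp).neg.congr_deriv (by ring)
  rw [← intervalIntegral.integral_const_mul, intervalIntegral.integral_eq_sub_of_hasDerivAt
    (fun s _ => h s) ((by fun_prop : Continuous fun s =>
      3 * a * Real.exp (3 * a * (T - s))).intervalIntegrable _ _)]
  simp

/-- Write `w_t = p - a w`. Here `a²‖∇w(s)‖²` is at most `2a e^{3a(T-s)}` times the data, and
integrating the exponential gains `1 / (3a)`, so no power of `a` is lost. The total factor is `1 +
4/3 ≤ 3`. -/
theorem IsApproximateSolution.integral_grad_vel_le [CompleteSpace V] [CompleteSpace H]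
    {pos velV : ℝ → V} {vel : ℝ → H} {acc : ℝ → V → ℝ} {ρ : ℝ → ℝ}
    (hs : IsApproximateSolution j D P T pos velV vel acc ρ) (hT : 0 < T) (ha : 2 ≤ a)
    (hP : ∀ h, ‖P h‖ ≤ a * ‖h‖) {t : ℝ} (ht : t ∈ Icc 0 T) :
    ∫ s in t..T, ‖D (velV s)‖ ^ 2 ≤ 3 * (Real.exp (3 * a * (T - t))
        * (weightedEnergy j D a (pos T) (vel T) + ∫ s in Ioo 0 T, ρ s ^ 2)) := by
  set S := weightedEnergy j D a (pos T) (vel T) + ∫ s in Ioo 0 T, ρ s ^ 2 with hS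
  have hS0 : 0 ≤ S := add_nonneg (weightedEnergy_nonneg (by linarith) _ _)
    (integral_nonneg fun s => sq_nonneg _)
  have hsub : Ioo t T ⊆ Ioo 0 T := Ioo_subset_Ioo_left ht.1
  have hii : ∀ {f : ℝ → ℝ}, IntegrableOn f (Ioo 0 T) → IntervalIntegrable f volume t T :=
    fun hf => (intervalIntegrable_iff_integrableOn_Ioo_of_le ht.2).2 (hf.mono_set hsub)
  have hp := hii (hs.integrableOn_gradient (a := a))
  have hw : IntervalIntegrable (fun s => ‖D (pos s)‖ ^ 2) volume t T :=
    hii ((D.comp_memLp' (memLp_of_continuousOn_Icc hs.continuousOn_pos)).integrable_norm_pow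
      (by simp))
  have hv : IntervalIntegrable (fun s => ‖D (velV s)‖ ^ 2) volume t T :=
    hii ((D.comp_memLp' hs.memLp_velV).integrable_norm_pow (by simp))
  have he : IntervalIntegrable (fun s => Real.exp (3 * a * (T - s))) volume t T :=
    (by fun_prop : Continuous fun s => Real.exp (3 * a * (T - s))).intervalIntegrable _ _
  have h1 : ∫ s in t..T, ‖D (velV s)‖ ^ 2 ≤ 2 * (∫ s in t..T, ‖D (velV s + a • pos s)‖ ^ 2)
      + 2 * a ^ 2 * ∫ s in t..T, ‖D (pos s)‖ ^ 2 := by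
    rw [← intervalIntegral.integral_const_mul, ← intervalIntegral.integral_const_mul,
      ← intervalIntegral.integral_add (hp.const_mul _) (hw.const_mul _)]
    refine intervalIntegral.integral_mono_on ht.2 hv ((hp.const_mul _).add (hw.const_mul _))
      fun s _ => ?_
    have := norm_sub_sq_le_two_mul (D (velV s + a • pos s)) (a • D (pos s))
    rw [norm_smul a, mul_pow, Real.norm_eq_abs, sq_abs, map_add, map_smul,
      add_sub_cancel_right] at this
    rw [map_add, map_smul]
    linarith
  have h2 : a * ∫ s in t..T, ‖D (pos s)‖ ^ 2
      ≤ 2 * S * ∫ s in t..T, Real.exp (3 * a * (T - s)) := by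
    rw [← intervalIntegral.integral_const_mul, ← intervalIntegral.integral_const_mul]
    refine intervalIntegral.integral_mono_on ht.2 (hw.const_mul _) (he.const_mul _) fun s hst => ?_
    have h3 := hs.energy_inequality hT ha hP (t := s) ⟨ht.1.trans hst.1, hst.2⟩
    have h4 : 0 ≤ ∫ r in s..T, ‖D (velV r + a • pos r)‖ ^ 2 :=
      intervalIntegral.integral_nonneg hst.2 fun r _ => sq_nonneg _
    have h5 := mul_norm_grad_le_weightedEnergy (j := j) (D := D) ha (pos s) (vel s)
    linarith
  have h3 := mul_le_mul_of_nonneg_left (integral_exp_mul_sub_le (T := T) (a := a) t) hS0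
  have h4 := hs.energy_inequality hT ha hP ht
  have h5 := weightedEnergy_nonneg (j := j) (D := D) (by linarith : 1 ≤ a) (pos t) (vel t)
  have h6 := mul_le_mul_of_nonneg_left h2 (by linarith : 0 ≤ a)
  have h7 : 0 ≤ S * Real.exp (3 * a * (T - t)) := mul_nonneg hS0 (Real.exp_pos _).le
  rw [← hS] at h4
  linarith

theorem weightedEnergy_le {w : V} {v : H} {x ε : ℝ} (ha : 2 ≤ a)
    (hx : ‖j w‖ ^ 2 + ‖D w‖ ^ 2 = x ^ 2) (hx0 : 0 ≤ x) (hε : x + ‖v‖ ≤ ε) :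
    weightedEnergy j D a w v ≤ 2 * a ^ 2 * ε ^ 2 := by
  have h1 : ‖j w‖ ≤ x := abs_le_of_sq_le_sq' (by nlinarith [sq_nonneg ‖D w‖]) hx0 |>.2
  have h2 : ‖v + a • j w‖ ≤ a * ε := by
    refine (norm_add_le _ _).trans ?_
    rw [norm_smul, Real.norm_of_nonneg (by linarith)]
    nlinarith [norm_nonneg v]
  have h3 : ‖v + a • j w‖ ^ 2 ≤ (a * ε) ^ 2 := by gcongr
  have h4 : x ^ 2 ≤ ε ^ 2 := by
    have : x ≤ ε := by linarith [norm_nonneg v]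
    gcongr
  have h5 : (a ^ 2 - a) * ‖j w‖ ^ 2 ≤ a ^ 2 * ‖j w‖ ^ 2 :=
    mul_le_mul_of_nonneg_right (by linarith) (sq_nonneg _)
  have h6 : (a - 1) * ‖D w‖ ^ 2 ≤ a ^ 2 * ‖D w‖ ^ 2 :=
    mul_le_mul_of_nonneg_right (by nlinarith) (sq_nonneg _)
  have h7 := mul_le_mul_of_nonneg_left h4 (sq_nonneg a)
  rw [← hx] at h7
  unfold weightedEnergy
  linarith

theorem integral_residual_sq_le {W : Type*} [NormedAddCommGroup W] {U Z : ℝ → W} {M k : ℝ}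
    (hT : 0 < T) (hU : ContinuousOn U (Icc 0 T)) (hZ : MemLp Z 2 (volume.restrict (Ioo 0 T)))
    (hM : ∀ t ∈ Icc 0 T, ‖U t‖ ^ 2 + ∫ s in Ioo 0 T, ‖Z s‖ ^ 2 ≤ M) :
    ∫ t in Ioo 0 T, (k * (‖U t‖ + ‖Z t‖)) ^ 2 ≤ k ^ 2 * (2 * (M * (T + 1))) := by
  have hU2 : IntegrableOn (fun t => ‖U t‖ ^ 2) (Ioo 0 T) :=
    (memLp_of_continuousOn_Icc hU).integrable_norm_pow (by simp)
  have hZ2 : IntegrableOn (fun t => ‖Z t‖ ^ 2) (Ioo 0 T) := hZ.integrable_norm_pow (by simp)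
  have hI : 0 ≤ ∫ s in Ioo 0 T, ‖Z s‖ ^ 2 := integral_nonneg fun s => sq_nonneg _
  have h0 := hM 0 (left_mem_Icc.2 hT.le)
  have hUM : ∫ t in Ioo 0 T, ‖U t‖ ^ 2 ≤ T * M := by
    calc ∫ t in Ioo 0 T, ‖U t‖ ^ 2 ≤ ∫ t in Ioo 0 T, M :=
          setIntegral_mono_on hU2 (by simp) measurableSet_Ioo fun t ht => by
            linarith [hM t (Ioo_subset_Icc_self ht)]
      _ = T * M := by simp [hT.le]
  calc ∫ t in Ioo 0 T, (k * (‖U t‖ + ‖Z t‖)) ^ 2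
      ≤ ∫ t in Ioo 0 T, k ^ 2 * (2 * (‖U t‖ ^ 2 + ‖Z t‖ ^ 2)) := by
        refine integral_mono
          (((memLp_of_continuousOn_Icc hU).norm.add hZ.norm).const_mul k).integrable_sq
          (((hU2.add hZ2).const_mul 2).const_mul _) fun t => ?_
        have := mul_nonneg (sq_nonneg k) (sq_nonneg (‖U t‖ - ‖Z t‖))
        simp only
        linarith
    _ = k ^ 2 * (2 * ((∫ t in Ioo 0 T, ‖U t‖ ^ 2) + ∫ t in Ioo 0 T, ‖Z t‖ ^ 2)) := by
        rw [integral_const_mul, integral_const_mul, integral_add hU2 hZ2]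
    _ ≤ _ := by
        refine mul_le_mul_of_nonneg_left ?_ (sq_nonneg k)
        nlinarith [sq_nonneg ‖U 0‖]

end Estimates

/-! ### The constant and the conclusion -/

/-- The constant of the error estimates, for `γ(ε)² ε ≤ k`. -/
noncomputable def errorConstant (k M C₀ C₁ : ℝ) : ℝ :=
  -- `2 / (3 C₁)` replaces `T`, which it exceeds when `3 C₁ T < 2`; hence the constant does not
  -- depend on `T`.
  let R := 2 * C₀ ^ 2 * (|M| * (2 / (3 * C₁) + 1))
  4 * k + R / C₁ + 4 * k * C₁ + R + 18 * k * C₁ ^ 2 + 9 * R * C₁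

theorem errorConstant_pos {k C₀ C₁ : ℝ} (M : ℝ) (hk : 0 < k) (hC₁ : 0 < C₁) :
    0 < errorConstant k M C₀ C₁ := by
  unfold errorConstant
  positivity

/-- The passage from the energy to the three error bounds. -/
theorem error_bounds_of_energy {k R C₁ L ε Γ X A B N C : ℝ} (hk : 0 < k) (hC₁ : 0 < C₁)
    (hL : 2 ≤ C₁ * L) (hε : 0 < ε) (hΓ : 0 < Γ) (hR : 0 ≤ R)
    (hX : X ≤ 2 * k * (C₁ * L) ^ 2 * ε + R * Γ)
    (hA : (C₁ * L) ^ 2 * A ≤ 2 * X) (hB : C₁ * L * B ≤ 2 * X) (hN : N ≤ 9 * X)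
    (hC : C = 4 * k + R / C₁ + 4 * k * C₁ + R + 18 * k * C₁ ^ 2 + 9 * R * C₁) :
    A ≤ C * (ε + L⁻¹ * Γ) ∧ B ≤ C * (L * ε + Γ) ∧ N ≤ C * (L ^ 2 * ε + L * Γ) := by
  have hL0 : 0 < L := by
    by_contra h
    nlinarith
  have hRC : R / C₁ * C₁ = R := div_mul_cancel₀ _ hC₁.ne'
  have hRC0 : 0 ≤ R / C₁ := by positivity
  have haL : 0 < C₁ * L := by positivity
  refine ⟨?_, ?_, ?_⟩
  -- Dividing by `(C₁ L)²` leaves `2RΓ / (C₁ L)²`; `C₁ L ≥ 2` reduces this to `RΓ / (C₁ L)`.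
  · have h1 : A ≤ 4 * k * ε + R / C₁ * (L⁻¹ * Γ) := by
      refine le_of_mul_le_mul_left ?_ (by positivity : 0 < (C₁ * L) ^ 2)
      have h2 : (C₁ * L) ^ 2 * (4 * k * ε + R / C₁ * (L⁻¹ * Γ))
          = 4 * k * (C₁ * L) ^ 2 * ε + (C₁ * L) * (R * Γ) := by
        field_simp
      rw [h2]
      nlinarith [mul_le_mul_of_nonneg_right hL (by positivity : 0 ≤ R * Γ)]
    have h2 : 4 * k ≤ C := by
      rw [hC]
      have : 0 ≤ R / C₁ + 4 * k * C₁ + R + 18 * k * C₁ ^ 2 + 9 * R * C₁ := by positivity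
      linarith
    have h3 : R / C₁ ≤ C := by
      rw [hC]
      have : 0 ≤ 4 * k + 4 * k * C₁ + R + 18 * k * C₁ ^ 2 + 9 * R * C₁ := by positivity
      linarith
    have h4 := mul_le_mul_of_nonneg_right h2 hε.le
    have h5 := mul_le_mul_of_nonneg_right h3 (by positivity : 0 ≤ L⁻¹ * Γ)
    linarith
  · have h1 : B ≤ 4 * k * C₁ * (L * ε) + R * Γ := by
      refine le_of_mul_le_mul_left ?_ haL
      nlinarith [mul_le_mul_of_nonneg_right hL (by positivity : 0 ≤ R * Γ)]
    have h2 : 4 * k * C₁ ≤ C := by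
      rw [hC]
      have : 0 ≤ 4 * k + R / C₁ + R + 18 * k * C₁ ^ 2 + 9 * R * C₁ := by positivity
      linarith
    have h3 : R ≤ C := by
      rw [hC]
      have : 0 ≤ 4 * k + R / C₁ + 4 * k * C₁ + 18 * k * C₁ ^ 2 + 9 * R * C₁ := by positivity
      linarith
    have h4 := mul_le_mul_of_nonneg_right h2 (by positivity : 0 ≤ L * ε)
    have h5 := mul_le_mul_of_nonneg_right h3 hΓ.le
    linarith
  · have h1 : N ≤ 18 * k * C₁ ^ 2 * (L ^ 2 * ε) + 9 * R * C₁ * (L * Γ) := by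
      have := mul_le_mul_of_nonneg_right hL (by positivity : 0 ≤ R * Γ)
      have : 0 ≤ R * Γ := by positivity
      linarith
    have h2 : 18 * k * C₁ ^ 2 ≤ C := by
      rw [hC]
      have : 0 ≤ 4 * k + R / C₁ + 4 * k * C₁ + R + 9 * R * C₁ := by positivity
      linarith
    have h3 : 9 * R * C₁ ≤ C := by
      rw [hC]
      have : 0 ≤ 4 * k + R / C₁ + 4 * k * C₁ + R + 18 * k * C₁ ^ 2 := by positivity
      linarith
    have h4 := mul_le_mul_of_nonneg_right h2 (by positivity : 0 ≤ L ^ 2 * ε)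
    have h5 := mul_le_mul_of_nonneg_right h3 (by positivity : 0 ≤ L * Γ)
    linarith

/-- The error estimates at a fixed noise level. -/
theorem errorEstimates_of_le {d : ℕ} {Ω : Set (Eu d)} {T k M C₀ C₁ : ℝ} (hk : 0 < k)
    (hC₁ : 0 < C₁) (hT : 0 < T) (hCT : 3 * C₁ * T < 2)
    {W : Type*} [NormedAddCommGroup W] [NormedSpace ℝ W]
    {ι : W →ₗ[ℝ] L2 Ω} {γ : ℝ → ℝ} {P : ℝ → L2 Ω →ₗ[ℝ] L2 Ω} {Q : ℝ → L2 Ω →ₗ.[ℝ] L2 Ω}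
    (hQ : IsPerturbing ι γ C₀ Q) (hP : IsStabilized γ C₁ P) (hPQ : IsLaplacePerturbation P Q)
    {f₀ : H1 Ω} {f₁ : L2 Ω} {u : Trajectory Ω T} (hu : IsExactSolution u)
    (huT : u.HasTerminalData f₀ f₁) (huM : u.HasSourceBound ι M)
    {ε : ℝ} (hε : ε ∈ Ioo (0 : ℝ) 1) (hγ : Real.exp (2 / C₁) ≤ γ ε) (hγε : γ ε ^ 2 * ε ≤ k)
    {f₀ε : H1 Ω} {f₁ε : L2 Ω} {y : Trajectory Ω T} (hy : IsRegularizedSolution (P ε) y)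
    (hyT : y.HasTerminalData f₀ε f₁ε) (hf : ‖f₀ε - f₀‖ + ‖f₁ε - f₁‖ ≤ ε) :
    ErrorEstimates (errorConstant k M C₀ C₁) C₁ (γ ε) ε y u := by
  intro t ht
  obtain ⟨U, Z, hU, hUu, hZ, hZu, hM⟩ := huM
  set g := γ ε with hg
  have hg0 : 0 < g := (Real.exp_pos _).trans_le hγ
  have hg1 : 1 ≤ g := (Real.one_le_exp (by positivity)).trans hγ
  -- The threshold `e^{2/C₁}` is exactly the condition `a ≥ 2`.
  have haL : 2 ≤ C₁ * Real.log g := by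
    have := (Real.le_log_iff_exp_le hg0).2 hγ
    rw [div_le_iff₀ hC₁] at this
    linarith
  set a := C₁ * Real.log g with ha
  have hPε : ∀ h, ‖P ε h‖ ≤ a * ‖h‖ := hP ε hε
  have hs := isApproximateSolution_sub hQ hPQ hε hy hu hU hUu hZ hZu
  have hen := hs.energy_inequality hT haL hPε ht
  have hgr := hs.integral_grad_vel_le hT haL hPε ht
  set R := 2 * C₀ ^ 2 * (|M| * (2 / (3 * C₁) + 1)) with hR
  have hR0 : 0 ≤ R := by positivity
  have hres : ∫ s in Ioo 0 T, (C₀ / g * (‖U s‖ + ‖Z s‖)) ^ 2 ≤ R / g ^ 2 := by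
    refine (integral_residual_sq_le hT hU hZ hM).trans ?_
    have h1 : T ≤ 2 / (3 * C₁) := by
      rw [le_div_iff₀ (by positivity)]
      linarith
    have h2 : M * (T + 1) ≤ |M| * (2 / (3 * C₁) + 1) :=
      mul_le_mul (le_abs_self M) (by linarith) (by linarith) (abs_nonneg M)
    calc (C₀ / g) ^ 2 * (2 * (M * (T + 1)))
        ≤ (C₀ / g) ^ 2 * (2 * (|M| * (2 / (3 * C₁) + 1))) := by gcongr
      _ = R / g ^ 2 := by rw [hR]; ring
  have hET : weightedEnergy H10.val H10.grad a (y.pos T - u.pos T) (y.vel T - u.vel T)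
      ≤ 2 * a ^ 2 * ε ^ 2 := by
    rw [← hyT.1, ← huT.1, ← hyT.2, ← huT.2] at hf
    exact weightedEnergy_le haL (H1.norm_sq_eq ((y.pos T - u.pos T : H10 Ω) : H1 Ω)).symm
      (norm_nonneg _) hf
  have hexp : Real.exp (3 * a * (T - t)) = g ^ (3 * C₁ * (T - t)) := by
    rw [Real.rpow_def_of_pos hg0, ha]
    ring_nf
  set Γ := g ^ (3 * C₁ * (T - t) - 2) with hΓ
  have hΓ0 : 0 < Γ := Real.rpow_pos_of_pos hg0 _
  have hΓg : g ^ (3 * C₁ * (T - t)) = Γ * g ^ 2 := by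
    rw [hΓ, ← Real.rpow_natCast g 2, ← Real.rpow_add hg0]
    norm_num
  have hΓ1 : Γ ≤ 1 := by
    refine Real.rpow_le_one_of_one_le_of_nonpos hg1 ?_
    nlinarith [ht.1]
  have hX : Real.exp (3 * a * (T - t))
      * (weightedEnergy H10.val H10.grad a (y.pos T - u.pos T) (y.vel T - u.vel T)
        + ∫ s in Ioo 0 T, (C₀ / g * (‖U s‖ + ‖Z s‖)) ^ 2) ≤ 2 * k * a ^ 2 * ε + R * Γ := by
    -- One factor of the `ε²` in the terminal energy is spent against `g²`, and `Γ ≤ 1` because `3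
    -- C₁ T < 2`.
    have h1 : Γ * (g ^ 2 * ε) ≤ k := by nlinarith [hε.1, sq_nonneg g]
    calc _ ≤ Γ * g ^ 2 * (2 * a ^ 2 * ε ^ 2 + R / g ^ 2) := by
          rw [hexp, hΓg]
          gcongr
      _ = 2 * a ^ 2 * ε * (Γ * (g ^ 2 * ε)) + R * Γ := by
          field_simp
      _ ≤ 2 * a ^ 2 * ε * k + R * Γ := by
          have := hε.1
          gcongr
      _ = _ := by ring
  have hint : 0 ≤ ∫ s in t..T, ‖H10.grad (y.velH10 s - u.velH10 s + a • (y.pos s - u.pos s))‖ ^ 2 :=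
    intervalIntegral.integral_nonneg ht.2 fun r _ => sq_nonneg _
  have hgrad : ∫ s in Ioo t T, ‖H1.grad (y.velH1 s) - H1.grad (u.velH1 s)‖ ^ 2
      = ∫ s in t..T, ‖H10.grad (y.velH10 s - u.velH10 s)‖ ^ 2 := by
    rw [intervalIntegral.integral_of_le ht.2, integral_Ioc_eq_integral_Ioo]
    apply integral_congr_ae
    have hsub := Measure.restrict_mono (Ioo_subset_Ioo_left ht.1 : Ioo t T ⊆ Ioo 0 T)
      (le_refl (volume : Measure ℝ))
    filter_upwards [ae_mono hsub y.velH1_eq, ae_mono hsub u.velH1_eq] with s h1 h2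
    rw [h1, h2, map_sub]
    rfl
  have hA := sq_mul_norm_le_weightedEnergy (j := H10.val) (D := H10.grad) haL
    (y.pos t - u.pos t) (y.vel t - u.vel t)
  have hB := mul_norm_grad_le_weightedEnergy (j := H10.val) (D := H10.grad) haL
    (y.pos t - u.pos t) (y.vel t - u.vel t)
  have hN := norm_vel_sq_le_weightedEnergy (j := H10.val) (D := H10.grad) haL
    (y.pos t - u.pos t) (y.vel t - u.vel t)
  rw [map_sub] at hA hB
  rw [hgrad]
  exact error_bounds_of_energy hk hC₁ haL hε.1 hΓ0 hR0 hX (hA.trans (by linarith))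
    (hB.trans (by linarith)) (by linarith) rfl

end QuasiReversibility

open QuasiReversibility in
theorem theorem2 (K M C₀ C₁ : ℝ) (hC₀ : 0 < C₀) (hC₁ : 0 < C₁) :
    ∃ C : ℝ, 0 < C ∧
      ∀ (d : ℕ) (Ω : Set (Eu d)) (_ : IsOpen Ω) (_ : Bornology.IsBounded Ω)
        (T : ℝ) (_ : 0 < T) (_ : 3 * C₁ * T < 2)
        (W : Type*) [NormedAddCommGroup W] [NormedSpace ℝ W]
        (ι : W →ₗ[ℝ] L2 Ω) (_ : Function.Injective ι)
        (γ : ℝ → ℝ) (_ : IsAuxiliary γ)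
        (P : ℝ → L2 Ω →ₗ[ℝ] L2 Ω) (Q : ℝ → L2 Ω →ₗ.[ℝ] L2 Ω)
        (_ : IsPerturbing ι γ C₀ Q) (_ : IsStabilized γ C₁ P) (_ : IsLaplacePerturbation P Q)
        (f₀ : H1 Ω) (f₁ : L2 Ω) (u : Trajectory Ω T)
        (_ : IsExactSolution u) (_ : u.HasTerminalData f₀ f₁) (_ : u.HasSourceBound ι M),
        -- every fixed noise level with `γ(ε) ≥ e^{2/C₁}` and `γ(ε)² ε ≤ K`
        (∀ ε ∈ Set.Ioo (0 : ℝ) 1, Real.exp (2 / C₁) ≤ γ ε → γ ε ^ 2 * ε ≤ K →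
          ∀ (f₀ε : H1 Ω) (f₁ε : L2 Ω) (uε : Trajectory Ω T),
            IsRegularizedSolution (P ε) uε → uε.HasTerminalData f₀ε f₁ε →
            ‖f₀ε - f₀‖ + ‖f₁ε - f₁‖ ≤ ε →
            ErrorEstimates C C₁ (γ ε) ε uε u) ∧
        -- every sufficiently small noise level, if `lim γ(ε)² ε ≤ K`
        (∀ l : ℝ, Filter.Tendsto (fun ε => γ ε ^ 2 * ε) (nhdsWithin 0 (Set.Ioi 0)) (nhds l) →
          l ≤ K →
          ∀ᶠ ε in nhdsWithin (0 : ℝ) (Set.Ioi 0),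
            ∀ (f₀ε : H1 Ω) (f₁ε : L2 Ω) (uε : Trajectory Ω T),
              IsRegularizedSolution (P ε) uε → uε.HasTerminalData f₀ε f₁ε →
              ‖f₀ε - f₀‖ + ‖f₁ε - f₁‖ ≤ ε →
              ErrorEstimates C C₁ (γ ε) ε uε u) := by
  -- `|K| + 1` is positive and strictly above `K`, so a limit at most `K` forces `γ² ε < |K| + 1`
  -- eventually.
  refine ⟨errorConstant (|K| + 1) M C₀ C₁, errorConstant_pos M (by positivity) hC₁, ?_⟩
  intro d Ω _ _ T hT hCT W _ _ ι _ γ hγ P Q hQ hP hPQ f₀ f₁ u hu huT huM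
  refine ⟨fun ε hε hγε hK f₀ε f₁ε uε huε huεT hf => ?_, fun l hl hlK => ?_⟩
  · exact errorEstimates_of_le (by positivity) hC₁ hT hCT hQ hP hPQ hu huT huM hε hγε
      (by linarith [le_abs_self K]) huε huεT hf
  · filter_upwards [Ioo_mem_nhdsGT (zero_lt_one (α := ℝ)),
      hγ.2.eventually_ge_atTop (Real.exp (2 / C₁)),
      hl.eventually (gt_mem_nhds (by linarith [le_abs_self K] : l < |K| + 1))]
      with ε hε hγε hK f₀ε f₁ε uε huε huεT hf
    exact errorEstimates_of_le (by positivity) hC₁ hT hCT hQ hP hPQ hu huT huM hε hγε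
      hK.le huε huεT hf
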